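/- **Theorem.** Index sequences by $\mathbb N=\{1,2,\dots\}$, let $c_{00}$ be the space of finitely supported real sequences with unit vectors $(e_i)_i$, and put $f(x)=\sum_i f_ix_i$ for $f,x\in c_{00}$. Write $f<g$ if $\max\operatorname{supp} f<\min\operatorname{supp} g$, where $\max\emptyset=0$ and $\min\emptyset=\infty$. For $G\subset c_{00}$, an *$\alpha$-average of $G$ of size $s$* is a vector $\frac1s(f_1+\dots+f_d)$ with $1\le d\le s$ and $f_1<\dots<f_d$ in $G$. A *Schreier functional of $G$* is a vector $\frac12(\alpha_1+\dots+\alpha_k)$, $k\ge1$, where $\alpha_1<\dots<\alpha_k$ are $\alpha$-averages of $G$ of sizes $s_1<\dots<s_k$ respectively, such that $k\le\min\operatorname{supp}\alpha_1$ and $s_i>\max\operatorname{supp}\alpha_{i-1}$ for $1<i\le k$. Let $W_{0,1}$ be the smallest set $W\subset c_{00}$ that satisfies $W=-W$ and contains every $e_i$, every $\alpha$-average of $W$ and every Schreier functional of $W$. Let $\mathfrak X^{1/2}_{0,1}$ be the completion of $c_{00}$ under the norm $\|x\|=\sup\{f(x):f\in W_{0,1}\}$. Then the following hold. 1. $\mathfrak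 X^{1/2}_{0,1}$ is asymptotically symmetric with constant $4$: for every $n$, all bounded sequences $(x^{(i)}_j)_j$, $1\le i\le n$, in $\mathfrak X^{1/2}_{0,1}$ and every permutation $\sigma$ of $\{1,\dots,n\}$, if the iterated limits $$L_1=\lim_{j_1\to\infty}\cdots\lim_{j_n\to\infty}\Big\|\sum_{i=1}^n x^{(i)}_{j_i}\Big\|,\qquad L_2=\lim_{j_1\to\infty}\cdots\lim_{j_n\to\infty}\Big\|\sum_{i=1}^n x^{(\sigma(i))}_{j_i}\Big\|$$ both exist, then $L_1\le 4L_2$. (Here an inner limit needs to exist only for all sufficiently large values of the next outer index.) 2. $\mathfrak X^{1/2}_{0,1}$ is infinite dimensional and no infinite dimensional closed subspace of it is an asymptotic-$\ell_p$ space, $1\le p<\infty$, or an asymptotic-$c_0$ space. Hence it is a negative answer to the problem of Junge, Kutzarova and Odell, whether every asymptotically symmetric Banach space has an infinite dimensional asymptotic-$\ell_p$ or asymptotic-$c_0$ subspace. Here a Banach space $X$ is asymptotic-$\ell_p$ (asymptotic-$c_0$ if $p=\infty$) if there is $C\ge1$ such that for every $n$ player (S) has a winning strategy in the following game. In each round $k=1,\dots,n$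 player (S) chooses a closed subspace $Y_k$ of $X$ of finite codimension and then player (V) chooses a norm-one vector $y_k\in Y_k$; player (S) wins if $C^{-1}\|a\|_{\ell_p^n}\le\|\sum_{k=1}^n a_ky_k\|\le C\|a\|_{\ell_p^n}$ for all $a\in\mathbb R^n$. -/

import Mathlib

open Filter Topology
open scoped ENNReal

noncomputable section

namespace AsympSym

/-! ### Finitely supported sequences and the norming set

The index set is `ℕ+ = {1, 2, 3, …}`, and `ℕ+ →₀ ℝ` is the space of real sequences with finitely
many nonzero entries. -/

/-- `f < g` for finitely supported sequences: `max supp f < min supp g`, with the conventions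
`max ∅ = 0` and `min ∅ = ∞`. -/
def Before (f g : ℕ+ →₀ ℝ) : Prop :=
  ∀ i ∈ f.support, ∀ j ∈ g.support, i < j

/-- The usual inner product `f(x) = ∑ i, f i * x i`. -/
def pairing (f x : ℕ+ →₀ ℝ) : ℝ :=
  f.sum fun i c => c * x i

/-- `a` is an `α`-average of `G` of size `s`: `a = (1/s)(f₁ + ⋯ + f_d)` with `1 ≤ d ≤ s` and
`f₁ < ⋯ < f_d` in `G`. -/
def IsAlphaAverage (G : Set (ℕ+ →₀ ℝ)) (s : ℕ) (a : ℕ+ →₀ ℝ) : Prop :=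
  ∃ d : ℕ, 1 ≤ d ∧ d ≤ s ∧ ∃ f : Fin d → (ℕ+ →₀ ℝ),
    (∀ i, f i ∈ G) ∧ (∀ i j, i < j → Before (f i) (f j)) ∧
    a = (1 / (s : ℝ)) • ∑ i, f i

/-- The finite sequence `a` is admissible: `a₁ < ⋯ < a_k` and `k ≤ min supp a₁`. -/
def IsAdmissible {k : ℕ} (a : Fin k → (ℕ+ →₀ ℝ)) : Prop :=
  (∀ i j, i < j → Before (a i) (a j)) ∧
  ∀ i : Fin k, (i : ℕ) = 0 → ∀ m ∈ (a i).support, k ≤ (m : ℕ)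

/-- The finite sequence `a`, whose terms have sizes `s`, is very fast growing: `a₁ < a₂ < ⋯`,
`s₁ < s₂ < ⋯`, and `s_j > max supp a_{j-1}` for `j > 1`. -/
def IsVeryFastGrowing {k : ℕ} (a : Fin k → (ℕ+ →₀ ℝ)) (s : Fin k → ℕ) : Prop :=
  (∀ i j, i < j → Before (a i) (a j)) ∧
  (∀ i j, i < j → s i < s j) ∧
  ∀ i j : Fin k, (j : ℕ) = (i : ℕ) + 1 → ∀ m ∈ (a i).support, (m : ℕ) < s j

/-- `f` is a Schreier functional of `G`: `f = (1/2)(a₁ + ⋯ + a_k)` for an admissible and very fast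
growing sequence of `α`-averages of `G`. -/
def IsSchreierFunctional (G : Set (ℕ+ →₀ ℝ)) (f : ℕ+ →₀ ℝ) : Prop :=
  ∃ k : ℕ, 1 ≤ k ∧ ∃ (a : Fin k → (ℕ+ →₀ ℝ)) (s : Fin k → ℕ),
    (∀ i, IsAlphaAverage G (s i) (a i)) ∧ IsAdmissible a ∧ IsVeryFastGrowing a s ∧
    f = (1 / 2 : ℝ) • ∑ i, a i

/-- `G` is symmetric, contains the unit vectors, and contains all its `α`-averages and all its
Schreier functionals. -/
structure IsNormingClosed (G : Set (ℕ+ →₀ ℝ)) : Prop where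
  symm : ∀ f ∈ G, -f ∈ G
  unit : ∀ i : ℕ+, Finsupp.single i (1 : ℝ) ∈ G
  average : ∀ (s : ℕ) (a : ℕ+ →₀ ℝ), IsAlphaAverage G s a → a ∈ G
  schreier : ∀ f : ℕ+ →₀ ℝ, IsSchreierFunctional G f → f ∈ G

/-- The norming set `W_{0,1}`: the smallest set with the above closure properties. -/
def W : Set (ℕ+ →₀ ℝ) :=
  ⋂₀ {G | IsNormingClosed G}

theorem IsAlphaAverage.mono {G H : Set (ℕ+ →₀ ℝ)} (h : G ⊆ H) {s : ℕ} {a : ℕ+ →₀ ℝ}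
    (ha : IsAlphaAverage G s a) : IsAlphaAverage H s a := by
  obtain ⟨d, h1, h2, f, hf, h3, h4⟩ := ha
  exact ⟨d, h1, h2, f, fun i => h (hf i), h3, h4⟩

theorem IsSchreierFunctional.mono {G H : Set (ℕ+ →₀ ℝ)} (h : G ⊆ H) {f : ℕ+ →₀ ℝ}
    (hf : IsSchreierFunctional G f) : IsSchreierFunctional H f := by
  obtain ⟨k, h1, a, s, ha, h2, h3, h4⟩ := hf
  exact ⟨k, h1, a, s, fun i => (ha i).mono h, h2, h3, h4⟩

theorem W_subset {G : Set (ℕ+ →₀ ℝ)} (hG : IsNormingClosed G) : W ⊆ G :=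
  Set.sInter_subset_of_mem hG

/-- The set `W` has the closure properties itself, so it is the least set that has them. -/
theorem isNormingClosed_W : IsNormingClosed W where
  symm f hf G hG := hG.symm f (hf G hG)
  unit i _ hG := hG.unit i
  average s a ha _ hG := hG.average s a (ha.mono (W_subset hG))
  schreier f hf _ hG := hG.schreier f (hf.mono (W_subset hG))

/-- The functionals in `W` have coefficients in `[-1, 1]`. -/
theorem abs_coeff_le_one {f : ℕ+ →₀ ℝ} (hf : f ∈ W) (i : ℕ+) : |f i| ≤ 1 := by
  have key : IsNormingClosed {f : ℕ+ →₀ ℝ | ∀ i, |f i| ≤ 1} := by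
    have avg : ∀ (s : ℕ) (a : ℕ+ →₀ ℝ),
        IsAlphaAverage {f : ℕ+ →₀ ℝ | ∀ i, |f i| ≤ 1} s a → ∀ i, |a i| ≤ 1 := by
      rintro s a ⟨d, h1, h2, g, hg, -, rfl⟩ i
      have hs : (0 : ℝ) < s := by exact_mod_cast (by omega : 0 < s)
      have hsum : |∑ j, g j i| ≤ (s : ℝ) := by
        calc |∑ j, g j i| ≤ ∑ j, |g j i| := Finset.abs_sum_le_sum_abs _ _
          _ ≤ ∑ _j : Fin d, (1 : ℝ) := Finset.sum_le_sum fun j _ => hg j i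
          _ = d := by simp
          _ ≤ s := by exact_mod_cast h2
      rw [Finsupp.smul_apply, Finsupp.finsetSum_apply, smul_eq_mul, abs_mul,
        abs_of_pos (by positivity), one_div, inv_mul_le_iff₀ hs, mul_one]
      exact hsum
    refine ⟨fun f hf i => by simpa using hf i, fun j i => ?_, avg, ?_⟩
    · rw [Finsupp.single_apply]; split_ifs <;> simp
    · rintro f ⟨k, -, a, s, ha, -, ⟨hb, -, -⟩, rfl⟩ i
      have hsum : |∑ j, a j i| ≤ 1 := by
        by_cases h : ∃ j, a j i ≠ 0
        · obtain ⟨j, hj⟩ := h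
          have hz : ∀ l, l ≠ j → a l i = 0 := by
            intro l hl
            by_contra hne
            rcases lt_or_gt_of_ne hl with h | h
            · exact lt_irrefl _ (hb l j h i (by simpa using hne) i (by simpa using hj))
            · exact lt_irrefl _ (hb j l h i (by simpa using hj) i (by simpa using hne))
          rw [Finset.sum_eq_single j (fun l _ hl => hz l hl) (by simp)]
          exact avg _ _ (ha j) i
        · push Not at h
          simp [h]
      rw [Finsupp.smul_apply, Finsupp.finsetSum_apply, smul_eq_mul, abs_mul]
      have : |(1 / 2 : ℝ)| = 1 / 2 := by norm_num
      rw [this]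
      linarith
  exact W_subset key hf i

theorem pairing_eq_sum (f x : ℕ+ →₀ ℝ) : pairing f x = ∑ i ∈ x.support, f i * x i := by
  classical
  unfold pairing Finsupp.sum
  have h1 : ∑ i ∈ f.support, f i * x i = ∑ i ∈ f.support ∪ x.support, f i * x i :=
    Finset.sum_subset Finset.subset_union_left (by
      intro i _ hi
      simp [Finsupp.notMem_support_iff.mp hi])
  have h2 : ∑ i ∈ x.support, f i * x i = ∑ i ∈ f.support ∪ x.support, f i * x i :=
    Finset.sum_subset Finset.subset_union_right (by
      intro i _ hi
      simp [Finsupp.notMem_support_iff.mp hi])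
  rw [h1, h2]

theorem pairing_add (f x y : ℕ+ →₀ ℝ) : pairing f (x + y) = pairing f x + pairing f y := by
  unfold pairing Finsupp.sum
  rw [← Finset.sum_add_distrib]
  exact Finset.sum_congr rfl fun i _ => by simp only [Finsupp.add_apply]; ring

theorem pairing_smul (f : ℕ+ →₀ ℝ) (c : ℝ) (x : ℕ+ →₀ ℝ) :
    pairing f (c • x) = c * pairing f x := by
  unfold pairing Finsupp.sum
  rw [Finset.mul_sum]
  exact Finset.sum_congr rfl fun i _ => by simp only [Finsupp.smul_apply, smul_eq_mul]; ring

theorem pairing_neg (f x : ℕ+ →₀ ℝ) : pairing (-f) x = -pairing f x := by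
  simp [pairing_eq_sum]

/-- The norm `‖x‖ = sup {f(x) : f ∈ W}`. -/
def normW (x : ℕ+ →₀ ℝ) : ℝ :=
  sSup ((fun f => pairing f x) '' W)

theorem bddAbove_pairing (x : ℕ+ →₀ ℝ) : BddAbove ((fun f => pairing f x) '' W) := by
  refine ⟨∑ i ∈ x.support, |x i|, ?_⟩
  rintro _ ⟨f, hf, rfl⟩
  simp only [pairing_eq_sum]
  refine Finset.sum_le_sum fun i _ => ?_
  calc f i * x i ≤ |f i * x i| := le_abs_self _
    _ = |f i| * |x i| := abs_mul _ _
    _ ≤ 1 * |x i| := by gcongr; exact abs_coeff_le_one hf i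
    _ = |x i| := one_mul _

theorem pairing_le_normW {f : ℕ+ →₀ ℝ} (hf : f ∈ W) (x : ℕ+ →₀ ℝ) : pairing f x ≤ normW x :=
  le_csSup (bddAbove_pairing x) ⟨f, hf, rfl⟩

theorem abs_pairing_le_normW {f : ℕ+ →₀ ℝ} (hf : f ∈ W) (x : ℕ+ →₀ ℝ) :
    |pairing f x| ≤ normW x :=
  abs_le'.mpr ⟨pairing_le_normW hf x, by
    rw [← pairing_neg]; exact pairing_le_normW (isNormingClosed_W.symm f hf) x⟩

theorem normW_le {x : ℕ+ →₀ ℝ} {r : ℝ} (h : ∀ f ∈ W, pairing f x ≤ r) : normW x ≤ r := by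
  refine csSup_le ⟨_, Finsupp.single 1 1, isNormingClosed_W.unit 1, rfl⟩ ?_
  rintro _ ⟨f, hf, rfl⟩
  exact h f hf

theorem abs_apply_le_normW (x : ℕ+ →₀ ℝ) (i : ℕ+) : |x i| ≤ normW x := by
  have h := abs_pairing_le_normW (isNormingClosed_W.unit i) x
  simpa [pairing] using h

theorem normW_nonneg (x : ℕ+ →₀ ℝ) : 0 ≤ normW x :=
  (abs_nonneg _).trans (abs_apply_le_normW x 1)

theorem normW_smul_le (c : ℝ) (x : ℕ+ →₀ ℝ) : normW (c • x) ≤ |c| * normW x := by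
  refine normW_le fun f hf => ?_
  rw [pairing_smul]
  calc c * pairing f x ≤ |c * pairing f x| := le_abs_self _
    _ = |c| * |pairing f x| := abs_mul _ _
    _ ≤ |c| * normW x := by gcongr; exact abs_pairing_le_normW hf x

theorem normW_smul (c : ℝ) (x : ℕ+ →₀ ℝ) : normW (c • x) = |c| * normW x := by
  refine le_antisymm (normW_smul_le c x) ?_
  rcases eq_or_ne c 0 with rfl | hc
  · simpa using normW_nonneg _
  · have h := normW_smul_le c⁻¹ (c • x)
    rw [smul_smul, inv_mul_cancel₀ hc, one_smul, abs_inv] at h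
    rwa [← le_inv_mul_iff₀ (abs_pos.mpr hc)]

theorem normW_add_le (x y : ℕ+ →₀ ℝ) : normW (x + y) ≤ normW x + normW y :=
  normW_le fun f hf => by
    rw [pairing_add]
    exact add_le_add (pairing_le_normW hf x) (pairing_le_normW hf y)

/-! ### The Banach space -/

/-- The space of finitely supported real sequences, to be normed by `normW`. -/
def C00 : Type := ℕ+ →₀ ℝ

instance : AddCommGroup C00 := inferInstanceAs (AddCommGroup (ℕ+ →₀ ℝ))

instance : Module ℝ C00 := inferInstanceAs (Module ℝ (ℕ+ →₀ ℝ))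

instance : Norm C00 := ⟨fun x => normW x⟩

theorem C00.core : NormedSpace.Core ℝ C00 where
  norm_nonneg x := normW_nonneg x
  norm_smul c x := normW_smul c x
  norm_triangle x y := normW_add_le x y
  norm_eq_zero_iff x := by
    constructor
    · intro h
      refine Finsupp.ext fun i => ?_
      have h' := abs_apply_le_normW x i
      have h'' : normW x = 0 := h
      rw [h''] at h'
      exact abs_nonpos_iff.mp h'
    · rintro rfl
      have h := normW_smul 0 (0 : ℕ+ →₀ ℝ)
      rw [zero_smul, abs_zero, zero_mul] at h
      exact h

instance : NormedAddCommGroup C00 := NormedAddCommGroup.ofCore C00.core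

instance : NormedSpace ℝ C00 := NormedSpace.ofCore C00.core

/-- The Banach space `𝔛^{1/2}_{0,1}`: the completion of the finitely supported sequences with
respect to the norm `normW`. -/
abbrev XHalf : Type := UniformSpace.Completion C00

/-! ### Asymptotic symmetry -/

/-- The iterated limit `lim_{j₁ → ∞} ⋯ lim_{jₙ → ∞} F (j₁, …, jₙ)` exists and equals `L`. The limit
in `jₙ` is the innermost one, and an inner limit has to exist for all sufficiently large values of
the next outer index. -/
def HasIteratedLimit : (n : ℕ) → ((Fin n → ℕ) → ℝ) → ℝ → Prop
  | 0, F, L => F Fin.elim0 = L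
  | n + 1, F, L => ∃ G : ℕ → ℝ,
      (∀ᶠ j in atTop, HasIteratedLimit n (fun t : Fin n → ℕ => F (Fin.cons j t)) (G j)) ∧
      Tendsto G atTop (𝓝 L)

/-- The normed space `X` is asymptotically symmetric with constant `C`. -/
def IsAsymptoticallySymmetricWith (C : ℝ) (X : Type*) [NormedAddCommGroup X] : Prop :=
  1 ≤ C ∧ ∀ (n : ℕ) (x : Fin n → ℕ → X) (σ : Equiv.Perm (Fin n)) (L₁ L₂ : ℝ),
    (∀ i, Bornology.IsBounded (Set.range (x i))) →
    HasIteratedLimit n (fun j => ‖∑ i, x i (j i)‖) L₁ →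
    HasIteratedLimit n (fun j => ‖∑ i, x (σ i) (j i)‖) L₂ →
    L₁ ≤ C * L₂

/-! ### Asymptotic-`ℓ_p` and asymptotic-`c₀` spaces -/

/-- The finite sequence `y` is `C`-equivalent to the unit vector basis of `ℓ_p^n`. For `p = ∞` the
norm on the coefficients is the maximum norm. -/
def IsEquivalentToLpBasis {X : Type*} [NormedAddCommGroup X] [NormedSpace ℝ X]
    (C : ℝ) (p : ℝ≥0∞) {n : ℕ} (y : Fin n → X) : Prop :=
  ∀ a : Fin n → ℝ,
    C⁻¹ * ‖(WithLp.toLp p a : PiLp p fun _ : Fin n => ℝ)‖ ≤ ‖∑ i, a i • y i‖ ∧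
    ‖∑ i, a i • y i‖ ≤ C * ‖(WithLp.toLp p a : PiLp p fun _ : Fin n => ℝ)‖

/-- `X` is an asymptotic-`ℓ_p` space (asymptotic-`c₀` if `p = ∞`): for some `C ≥ 1` and every `n`,
player (S) has a winning strategy in the following game of `n` rounds. In each round (S) chooses a
closed subspace of finite codimension, and then (V) chooses a vector of norm one in it. Player (S)
wins if the vectors chosen by (V) are `C`-equivalent to the unit vector basis of `ℓ_p^n`. A strategy
`S` assigns to the list of the earlier choices of (V) the next choice of (S). -/
def IsAsymptoticLp (p : ℝ≥0∞) (X : Type*) [NormedAddCommGroup X] [NormedSpace ℝ X] : Prop :=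
  ∃ C : ℝ, 1 ≤ C ∧ ∀ n : ℕ, ∃ S : List X → Submodule ℝ X,
    (∀ l, IsClosed (S l : Set X) ∧ FiniteDimensional ℝ (X ⧸ S l)) ∧
    ∀ y : Fin n → X,
      (∀ k : Fin n, ‖y k‖ = 1 ∧
        y k ∈ S (List.ofFn fun i : Fin k => y (Fin.castLE k.isLt.le i))) →
      IsEquivalentToLpBasis C p y

end AsympSym

end

namespace AsympSym

/-! ### Evaluation of functionals and lists of averages -/

/-! The norm of a sum of vectors placed very far apart is determined, up to a factor of 4, by data
that ignore their order. Along an ultrafilter, a bounded sequence splits into a fixed vector and a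
sequence `y` with negligible initial segments (`exists_eventually_normW_filter_le`). The second part
has a limit norm θ and an index δ (`exists_index`): roughly, the largest value on `y` of a sum of
boundedly many very fast growing averages whose sizes tend to infinity.

Lower estimate (`exists_lower_bound`): far out, the lists that realise the indices join into one
admissible list, so the norm of w + ∑ y_i is at least the maximum of ‖w‖, of each θ_i and of ½ ∑
δ_i, up to small errors.

Upper estimate (`normW_add_le_of_controlled`, iterated by `IsTail.add`): a Schreier functional that
touches a vector z of norm at most A has boundedly many terms. Let Z be the part after z, of norm at
most B. One average may straddle the start of Z and contributes at most B. All later ones have huge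
sizes and contribute at most the total index D. The value is at most A + (B + D)/2, and this is at
most B once B ≥ 2A + D. Averages preserve the bound B by convexity, so the norm stays below 2
max(‖w‖, θ_i) + ∑ δ_i. Compared with the lower estimate, this is at most 2 + 2 = 4 times the norm in
any other order.

Subspaces are excluded by the same two estimates. In an asymptotic-ℓ_p subspace with p < ∞,
normalized sums of long ℓ_p sequences have small averages (`exists_small_index`). The upper estimate
then bounds sums of n such vectors by a constant, against growth n^{1/p}. In an asymptotic-c₀
subspace, normalized sums carry averages of prescribed size with values bounded below
(`exists_large_index`). A Schreier functional adds n of these, against boundedness of the sum. -/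

/-- Evaluation of finitely supported functionals at a sequence of real numbers. -/
noncomputable def ev (c : ℕ+ → ℝ) : (ℕ+ →₀ ℝ) →ₗ[ℝ] ℝ := Finsupp.linearCombination ℝ c

theorem pairing_eq_ev (f x : ℕ+ →₀ ℝ) : pairing f x = ev x f := by
  simp [pairing, ev, Finsupp.linearCombination_apply]

theorem ev_congr {c c' : ℕ+ → ℝ} {f : ℕ+ →₀ ℝ} (h : ∀ i ∈ f.support, c i = c' i) :
    ev c f = ev c' f := by
  simp only [ev, Finsupp.linearCombination_apply]
  exact Finsupp.sum_congr fun i hi => by rw [h i hi]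

theorem ev_add (x y : ℕ+ →₀ ℝ) (f : ℕ+ →₀ ℝ) : ev (x + y : ℕ+ →₀ ℝ) f = ev x f + ev y f := by
  simp only [← pairing_eq_ev, pairing_add]

theorem ev_smul (c : ℝ) (x f : ℕ+ →₀ ℝ) : ev (c • x : ℕ+ →₀ ℝ) f = c * ev x f := by
  simp only [← pairing_eq_ev, pairing_smul]

theorem ev_neg (x f : ℕ+ →₀ ℝ) : ev (-x : ℕ+ →₀ ℝ) f = -ev x f := by
  have := ev_smul (-1) x f
  simpa using this

theorem ev_sub (x y : ℕ+ →₀ ℝ) (f : ℕ+ →₀ ℝ) : ev (x - y : ℕ+ →₀ ℝ) f = ev x f - ev y f := by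
  rw [sub_eq_add_neg, ev_add, ev_neg, sub_eq_add_neg]

theorem ev_zero_left (f : ℕ+ →₀ ℝ) : ev ((0 : ℕ+ →₀ ℝ) : ℕ+ → ℝ) f = 0 := by
  have := ev_smul 0 0 f
  simpa using this

theorem ev_sum {ι : Type*} (s : Finset ι) (x : ι → ℕ+ →₀ ℝ) (f : ℕ+ →₀ ℝ) :
    ev (∑ i ∈ s, x i : ℕ+ →₀ ℝ) f = ∑ i ∈ s, ev (x i) f := by
  classical
  induction s using Finset.induction_on with
  | empty => simpa using ev_zero_left f
  | insert a s ha ih => rw [Finset.sum_insert ha, Finset.sum_insert ha, ev_add, ih]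

theorem ev_eq_zero {c : ℕ+ → ℝ} {f : ℕ+ →₀ ℝ} (h : ∀ i ∈ f.support, c i = 0) : ev c f = 0 := by
  rw [ev_congr (c' := fun _ => 0) h]
  simp [ev, Finsupp.linearCombination_apply]

theorem ev_filter (p : ℕ+ → Prop) [DecidablePred p] (x f : ℕ+ →₀ ℝ) :
    ev (x.filter p) f = ev x (f.filter p) := by
  have h1 : ev (x.filter p) (f.filter p) = ev x (f.filter p) :=
    ev_congr fun i hi => by
      rw [Finsupp.support_filter, Finset.mem_filter] at hi
      exact Finsupp.filter_apply_pos _ _ hi.2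
  have h2 : ev (x.filter p) (f.filter fun i => ¬ p i) = 0 :=
    ev_eq_zero fun i hi => by
      rw [Finsupp.support_filter, Finset.mem_filter] at hi
      exact Finsupp.filter_apply_neg _ _ hi.2
  conv_lhs => rw [← Finsupp.filter_add_filter_not f p, map_add, h1, h2, add_zero]

theorem Before.mono {f f' g g' : ℕ+ →₀ ℝ} (h : Before f g) (hf : f'.support ⊆ f.support)
    (hg : g'.support ⊆ g.support) : Before f' g' :=
  fun i hi j hj => h i (hf hi) j (hg hj)

theorem Before.of_le {f g : ℕ+ →₀ ℝ} {T : ℕ} (hf : ∀ i ∈ f.support, (i : ℕ) ≤ T)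
    (hg : ∀ i ∈ g.support, T < (i : ℕ)) : Before f g :=
  fun i hi j hj => PNat.coe_lt_coe _ _ |>.mp ((hf i hi).trans_lt (hg j hj))

theorem exists_support_le (f : ℕ+ →₀ ℝ) : ∃ m : ℕ, ∀ i ∈ f.support, (i : ℕ) ≤ m :=
  ⟨f.support.sup fun i => (i : ℕ), fun _ hi => Finset.le_sup (f := fun i : ℕ+ => (i : ℕ)) hi⟩

theorem isAlphaAverage_list {G : Set (ℕ+ →₀ ℝ)} {s : ℕ} {l : List (ℕ+ →₀ ℝ)} (h0 : l ≠ [])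
    (hs : l.length ≤ s) (hG : ∀ f ∈ l, f ∈ G) (hB : l.Pairwise Before) :
    IsAlphaAverage G s ((1 / (s : ℝ)) • l.sum) := by
  refine ⟨l.length, List.length_pos_iff.mpr h0, hs, l.get, fun i => hG _ (List.get_mem _ _),
    fun i j hij => List.pairwise_iff_get.mp hB i j hij, ?_⟩
  rw [← List.sum_ofFn, List.ofFn_get]

theorem IsAlphaAverage.exists_list {G : Set (ℕ+ →₀ ℝ)} {s : ℕ} {a : ℕ+ →₀ ℝ}
    (h : IsAlphaAverage G s a) : ∃ l : List (ℕ+ →₀ ℝ), l ≠ [] ∧ l.length ≤ s ∧ (∀ f ∈ l, f ∈ G) ∧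
      l.Pairwise Before ∧ a = (1 / (s : ℝ)) • l.sum := by
  obtain ⟨d, h1, h2, f, hf, hB, rfl⟩ := h
  refine ⟨List.ofFn f, ?_, by simpa using h2, ?_, List.pairwise_ofFn.mpr fun i j => hB i j, ?_⟩
  · intro h
    have := congrArg List.length h
    simp at this
    omega
  · intro g hg
    obtain ⟨i, rfl⟩ := (List.mem_ofFn' _ _).mp hg
    exact hf i
  · rw [List.sum_ofFn]

/-- A list of `α`-averages of `G`, paired with their sizes, that is very fast growing. -/
def VFG (G : Set (ℕ+ →₀ ℝ)) (Γ : List ((ℕ+ →₀ ℝ) × ℕ)) : Prop :=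
  (∀ p ∈ Γ, IsAlphaAverage G p.2 p.1) ∧
  Γ.Pairwise fun p q : (ℕ+ →₀ ℝ) × ℕ => Before p.1 q.1 ∧ p.2 < q.2 ∧ ∀ m ∈ p.1.support, (m : ℕ) < q.2

/-- The number of terms of the list is at most the minimum of their supports. -/
def Adm (Γ : List ((ℕ+ →₀ ℝ) × ℕ)) : Prop :=
  ∀ p ∈ Γ, ∀ m ∈ p.1.support, Γ.length ≤ (m : ℕ)

/-- The sum of the functionals in a list. -/
noncomputable def tot (Γ : List ((ℕ+ →₀ ℝ) × ℕ)) : ℕ+ →₀ ℝ := (Γ.map Prod.fst).sum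

@[simp] theorem tot_nil : tot [] = 0 := rfl

@[simp] theorem tot_cons (p : (ℕ+ →₀ ℝ) × ℕ) (Γ : List ((ℕ+ →₀ ℝ) × ℕ)) :
    tot (p :: Γ) = p.1 + tot Γ := rfl

@[simp] theorem tot_append (Γ Δ : List ((ℕ+ →₀ ℝ) × ℕ)) : tot (Γ ++ Δ) = tot Γ + tot Δ := by
  simp [tot]

theorem ev_tot_eq_zero {c : ℕ+ → ℝ} {Γ : List ((ℕ+ →₀ ℝ) × ℕ)}
    (h : ∀ p ∈ Γ, ∀ i ∈ p.1.support, c i = 0) : ev c (tot Γ) = 0 := by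
  induction Γ with
  | nil => simp
  | cons p Γ ih =>
    rw [tot_cons, map_add, ev_eq_zero (h p (by simp)),
      ih fun q hq => h q (List.mem_cons_of_mem _ hq), add_zero]

theorem VFG.mono {G H : Set (ℕ+ →₀ ℝ)} (h : G ⊆ H) {Γ : List ((ℕ+ →₀ ℝ) × ℕ)} (hΓ : VFG G Γ) :
    VFG H Γ :=
  ⟨fun p hp => (hΓ.1 p hp).mono h, hΓ.2⟩

theorem VFG.sublist {G : Set (ℕ+ →₀ ℝ)} {Γ Δ : List ((ℕ+ →₀ ℝ) × ℕ)} (hΓ : VFG G Γ)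
    (h : Δ.Sublist Γ) : VFG G Δ :=
  ⟨fun p hp => hΓ.1 p (h.subset hp), hΓ.2.sublist h⟩

theorem Adm.sublist {Γ Δ : List ((ℕ+ →₀ ℝ) × ℕ)} (hΓ : Adm Γ) (h : Δ.Sublist Γ) : Adm Δ :=
  fun p hp m hm => h.length_le.trans (hΓ p (h.subset hp) m hm)

theorem VFG.nil {G : Set (ℕ+ →₀ ℝ)} : VFG G [] := ⟨by simp, List.Pairwise.nil⟩

theorem VFG.append {G : Set (ℕ+ →₀ ℝ)} {Γ Δ : List ((ℕ+ →₀ ℝ) × ℕ)} (hΓ : VFG G Γ) (hΔ : VFG G Δ)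
    {T : ℕ} (h1 : ∀ p ∈ Γ, p.2 ≤ T ∧ ∀ m ∈ p.1.support, (m : ℕ) ≤ T)
    (h2 : ∀ p ∈ Δ, T < p.2 ∧ ∀ m ∈ p.1.support, T < (m : ℕ)) : VFG G (Γ ++ Δ) := by
  refine ⟨fun p hp => (List.mem_append.mp hp).elim (hΓ.1 p) (hΔ.1 p),
    List.pairwise_append.mpr ⟨hΓ.2, hΔ.2, fun p hp q hq => ⟨?_, ?_, ?_⟩⟩⟩
  · exact Before.of_le (h1 p hp).2 (h2 q hq).2
  · exact (h1 p hp).1.trans_lt (h2 q hq).1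
  · exact fun m hm => ((h1 p hp).2 m hm).trans_lt (h2 q hq).1

theorem isSchreierFunctional_list {G : Set (ℕ+ →₀ ℝ)} {Γ : List ((ℕ+ →₀ ℝ) × ℕ)} (h0 : Γ ≠ [])
    (hΓ : VFG G Γ) (hA : Adm Γ) : IsSchreierFunctional G ((1 / 2 : ℝ) • tot Γ) := by
  have hp : ∀ i j : Fin Γ.length, i < j → Before (Γ.get i).1 (Γ.get j).1 ∧
      (Γ.get i).2 < (Γ.get j).2 ∧ ∀ m ∈ (Γ.get i).1.support, (m : ℕ) < (Γ.get j).2 :=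
    fun i j hij => List.pairwise_iff_get.mp hΓ.2 i j hij
  refine ⟨Γ.length, List.length_pos_iff.mpr h0, fun i => (Γ.get i).1, fun i => (Γ.get i).2,
    fun i => hΓ.1 _ (List.get_mem _ _), ⟨fun i j hij => (hp i j hij).1, fun i _ m hm =>
      hA _ (List.get_mem _ _) m hm⟩, ⟨fun i j hij => (hp i j hij).1, fun i j hij => (hp i j hij).2.1,
      fun i j hij => (hp i j (Fin.lt_def.mpr (by omega))).2.2⟩, ?_⟩
  rw [tot, ← List.sum_ofFn]
  congr 2
  conv_lhs => rw [← List.ofFn_get Γ, List.map_ofFn]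
  rfl

/-- Admissibility as defined constrains only the first average and would be void if that average
vanished. Since `G` omits zero, the first average has a support point, and the order of the supports
passes the constraint on to all later terms, as `Adm` demands. -/
theorem IsSchreierFunctional.exists_list {G : Set (ℕ+ →₀ ℝ)} (hG : ∀ f ∈ G, f ≠ 0)
    {f : ℕ+ →₀ ℝ} (h : IsSchreierFunctional G f) :
    ∃ Γ, Γ ≠ [] ∧ VFG G Γ ∧ Adm Γ ∧ f = (1 / 2 : ℝ) • tot Γ := by
  obtain ⟨k, hk, a, s, ha, ⟨-, hadm⟩, ⟨hB, hs, hv⟩, rfl⟩ := h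
  have hv' : ∀ i j : Fin k, i < j → ∀ m ∈ (a i).support, (m : ℕ) < s j := by
    intro i j hij m hm
    have hlt : (i : ℕ) + 1 < k := by have := j.2; have := Fin.lt_def.mp hij; omega
    have h1 := hv i ⟨i + 1, hlt⟩ rfl m hm
    rcases eq_or_lt_of_le (show (⟨i + 1, hlt⟩ : Fin k) ≤ j from Nat.succ_le_of_lt hij) with h | h
    · exact h ▸ h1
    · exact h1.trans (hs _ _ h)
  have hne : ∃ m, m ∈ (a ⟨0, hk⟩).support := by
    obtain ⟨d, h1, h2, g, hg, hBg, he⟩ := ha ⟨0, hk⟩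
    have h0 := hG _ (hg ⟨0, h1⟩)
    obtain ⟨m, hm⟩ := Finsupp.support_nonempty_iff.mpr h0
    refine ⟨m, ?_⟩
    rw [he, Finsupp.mem_support_iff, Finsupp.smul_apply, Finsupp.finsetSum_apply,
      Finset.sum_eq_single ⟨0, h1⟩]
    · have : (s ⟨0, hk⟩ : ℝ) ≠ 0 := by exact_mod_cast (by omega : s ⟨0, hk⟩ ≠ 0)
      simpa [this] using hm
    · intro b _ hb
      by_contra hbm
      exact lt_irrefl _ (hBg ⟨0, h1⟩ b (by rw [Fin.lt_def]; simp [Fin.ext_iff] at hb; simp; omega) m hm m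
        (by simpa using hbm))
    · simp
  obtain ⟨m₀, hm₀⟩ := hne
  refine ⟨List.ofFn fun i => (a i, s i), ?_, ⟨?_, ?_⟩, ?_, ?_⟩
  · intro h
    have := congrArg List.length h
    simp at this
    omega
  · intro p hp
    obtain ⟨i, rfl⟩ := (List.mem_ofFn' _ _).mp hp
    exact ha i
  · exact List.pairwise_ofFn.mpr fun i j hij => ⟨hB i j hij, hs i j hij, hv' i j hij⟩
  · intro p hp m hm
    obtain ⟨i, rfl⟩ := (List.mem_ofFn' _ _).mp hp
    rw [List.length_ofFn]
    by_cases hi : (i : ℕ) = 0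
    · exact hadm i hi m hm
    · have h1 := hadm ⟨0, hk⟩ rfl m₀ hm₀
      have h2 : m₀ < m := hB ⟨0, hk⟩ i (by rw [Fin.lt_def]; simp; omega) m₀ hm₀ m hm
      exact h1.trans (PNat.coe_le_coe _ _ |>.mpr h2.le)
  · rw [tot, List.map_ofFn, List.sum_ofFn]
    rfl

theorem list_sum_ne_zero {l : List (ℕ+ →₀ ℝ)} (h0 : l ≠ []) (h : ∀ f ∈ l, f ≠ 0)
    (hB : l.Pairwise Before) : l.sum ≠ 0 := by
  cases l with
  | nil => exact absurd rfl h0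
  | cons f l =>
    obtain ⟨m, hm⟩ := Finsupp.support_nonempty_iff.mpr (h f (by simp))
    intro hz
    have hzm := DFunLike.congr_fun hz m
    have hl : l.sum m = 0 := by
      have hB' := (List.pairwise_cons.mp hB).1
      clear hB hz hzm h h0
      induction l with
      | nil => simp
      | cons g l ih =>
        have hg : g m = 0 := by
          by_contra hne
          exact lt_irrefl _ (hB' g (by simp) m hm m (by simpa using hne))
        rw [List.sum_cons, Finsupp.add_apply, hg, ih fun g hg => hB' g (List.mem_cons_of_mem _ hg),
          add_zero]
    rw [List.sum_cons, Finsupp.add_apply, hl, add_zero] at hzm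
    exact (Finsupp.mem_support_iff.mp hm) hzm

theorem IsAlphaAverage.ne_zero {G : Set (ℕ+ →₀ ℝ)} (hG : ∀ f ∈ G, f ≠ 0) {s : ℕ} {a : ℕ+ →₀ ℝ}
    (h : IsAlphaAverage G s a) : a ≠ 0 := by
  obtain ⟨l, h0, hs, hl, hB, rfl⟩ := h.exists_list
  have h1 := list_sum_ne_zero h0 (fun f hf => hG f (hl f hf)) hB
  have h2 : (s : ℝ) ≠ 0 := by
    have := List.length_pos_iff.mpr h0
    exact_mod_cast (by omega : s ≠ 0)
  simp [h1, h2]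

/-- Induction over the construction of `W`. -/
theorem W_induction {P : (ℕ+ →₀ ℝ) → Prop} (single : ∀ i, P (Finsupp.single i 1))
    (neg : ∀ f ∈ W, P f → P (-f))
    (avg : ∀ (s : ℕ) (l : List (ℕ+ →₀ ℝ)), l ≠ [] → l.length ≤ s → (∀ f ∈ l, f ∈ W ∧ P f) →
      l.Pairwise Before → P ((1 / (s : ℝ)) • l.sum))
    (schreier : ∀ Γ, Γ ≠ [] → VFG {f | f ∈ W ∧ P f} Γ → Adm Γ → P ((1 / 2 : ℝ) • tot Γ))
    {f : ℕ+ →₀ ℝ} (hf : f ∈ W) : P f := by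
  -- Nonvanishing is carried along in the induction because the passage from Schreier functionals to
  -- lists satisfying `Adm` needs it.
  have key : IsNormingClosed {f | (f ∈ W ∧ P f) ∧ f ≠ 0} := by
    have hs1 : {f | (f ∈ W ∧ P f) ∧ f ≠ 0} ⊆ {f | f ∈ W ∧ P f} := fun f hf => hf.1
    have hs2 : {f | (f ∈ W ∧ P f) ∧ f ≠ 0} ⊆ W := fun f hf => hf.1.1
    refine ⟨fun f hf => ⟨⟨isNormingClosed_W.symm f hf.1.1, neg f hf.1.1 hf.1.2⟩, by simpa using hf.2⟩,
      fun i => ⟨⟨isNormingClosed_W.unit i, single i⟩, by simp⟩, fun s a ha => ⟨⟨?_, ?_⟩, ?_⟩,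
      fun f hf => ⟨⟨?_, ?_⟩, ?_⟩⟩
    · exact isNormingClosed_W.average s a (ha.mono hs2)
    · obtain ⟨l, h0, hs, hl, hB, rfl⟩ := (ha.mono hs1).exists_list
      exact avg s l h0 hs hl hB
    · exact ha.ne_zero fun f hf => hf.2
    · exact isNormingClosed_W.schreier f (hf.mono hs2)
    · obtain ⟨Γ, h0, hΓ, hA, rfl⟩ := hf.exists_list fun f hf => hf.2
      exact schreier Γ h0 (hΓ.mono hs1) hA
    · obtain ⟨Γ, h0, hΓ, hA, rfl⟩ := hf.exists_list fun f hf => hf.2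
      have := list_sum_ne_zero (l := Γ.map Prod.fst) (by simpa using h0) (by
        intro g hg
        obtain ⟨p, hp, rfl⟩ := List.mem_map.mp hg
        exact (hΓ.1 p hp).ne_zero fun f hf => hf.2)
        (List.pairwise_map.mpr (hΓ.2.imp fun h => h.1))
      simpa [tot] using this
  exact ((W_subset key) hf).1.2

theorem avg_mem_W {s : ℕ} {a : ℕ+ →₀ ℝ} (h : IsAlphaAverage W s a) : a ∈ W :=
  isNormingClosed_W.average s a h

/-! ### Restriction of functionals to sets of coordinates -/

theorem list_sum_filter_ne_zero {M : Type*} [AddCommMonoid M] [DecidableEq M] (l : List M) :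
    (l.filter (· ≠ 0)).sum = l.sum := by
  induction l with
  | nil => rfl
  | cons a l ih =>
    by_cases h : a = 0
    · simpa [h] using ih
    · rw [List.filter_cons_of_pos (by simpa using h), List.sum_cons, List.sum_cons, ih]

theorem filter_list_sum (p : ℕ+ → Prop) [DecidablePred p] (l : List (ℕ+ →₀ ℝ)) :
    l.sum.filter p = (l.map fun f => f.filter p).sum := by
  induction l with
  | nil => exact Finsupp.filter_zero p
  | cons a l ih => simp [ih, Finsupp.filter_add]

theorem support_filter_subset (p : ℕ+ → Prop) [DecidablePred p] (f : ℕ+ →₀ ℝ) :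
    (f.filter p).support ⊆ f.support := by
  rw [Finsupp.support_filter]; exact Finset.filter_subset _ _

/-- The size `s` is only an upper bound for the number of summands, so those that vanish after
restriction can be dropped without changing `s`. -/
theorem IsAlphaAverage.filter {G H : Set (ℕ+ →₀ ℝ)} {p : ℕ+ → Prop} [DecidablePred p]
    (h : ∀ f ∈ G, f.filter p = 0 ∨ f.filter p ∈ H) {s : ℕ} {a : ℕ+ →₀ ℝ}
    (ha : IsAlphaAverage G s a) : a.filter p = 0 ∨ IsAlphaAverage H s (a.filter p) := by
  classical
  obtain ⟨l, -, hs, hl, hB, rfl⟩ := ha.exists_list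
  set l' := (l.map fun f => f.filter p).filter (· ≠ 0) with hl'
  have he : ((1 / (s : ℝ)) • l.sum).filter p = (1 / (s : ℝ)) • l'.sum := by
    rw [Finsupp.filter_smul, filter_list_sum, hl', list_sum_filter_ne_zero]
  rw [he]
  by_cases h0 : l' = []
  · left; simp [h0]
  · right
    refine isAlphaAverage_list h0 ?_ ?_ ?_
    · exact (List.length_filter_le _ _).trans (by simpa using hs)
    · intro g hg
      obtain ⟨hg1, hg2⟩ := List.mem_filter.mp hg
      obtain ⟨f, hf, rfl⟩ := List.mem_map.mp hg1
      exact (h f (hl f hf)).resolve_left (by simpa using hg2)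
    · exact (List.pairwise_map.mpr (hB.imp fun hfg => hfg.mono (support_filter_subset p _)
        (support_filter_subset p _))).filter _

theorem VFG.filter {G H : Set (ℕ+ →₀ ℝ)} {p : ℕ+ → Prop} [DecidablePred p]
    (h : ∀ f ∈ G, f.filter p = 0 ∨ f.filter p ∈ H) {Γ : List ((ℕ+ →₀ ℝ) × ℕ)} (hΓ : VFG G Γ) :
    ∃ Δ, VFG H Δ ∧ tot Δ = (tot Γ).filter p ∧ Δ.length ≤ Γ.length ∧
      ∀ q ∈ Δ, ∃ r ∈ Γ, q.2 = r.2 ∧ q.1 = r.1.filter p := by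
  classical
  set Δ := (Γ.map fun q => (q.1.filter p, q.2)).filter (fun q => q.1 ≠ 0) with hΔ
  have hmem : ∀ q ∈ Δ, q.1 ≠ 0 ∧ ∃ r ∈ Γ, q.2 = r.2 ∧ q.1 = r.1.filter p := by
    intro q hq
    obtain ⟨hq1, hq2⟩ := List.mem_filter.mp hq
    obtain ⟨r, hr, rfl⟩ := List.mem_map.mp hq1
    exact ⟨by simpa using hq2, r, hr, rfl, rfl⟩
  refine ⟨Δ, ⟨fun q hq => ?_, ?_⟩, ?_, ?_, fun q hq => (hmem q hq).2⟩
  · obtain ⟨h0, r, hr, h2, h1⟩ := hmem q hq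
    rw [h2, h1]
    exact ((hΓ.1 r hr).filter h).resolve_left (h1 ▸ h0)
  · exact (List.pairwise_map.mpr (hΓ.2.imp fun hqr => ⟨hqr.1.mono (support_filter_subset p _)
      (support_filter_subset p _), hqr.2.1, fun m hm => hqr.2.2 m (support_filter_subset p _ hm)⟩)).filter _
  · rw [tot, tot, filter_list_sum, ← list_sum_filter_ne_zero (List.map _ (List.map _ Γ)), hΔ]
    congr 1
    simp only [List.map_map, List.filter_map]
    rfl
  · exact (List.length_filter_le _ _).trans (by simp)

theorem half_tot_mem_W {Γ : List ((ℕ+ →₀ ℝ) × ℕ)} (h0 : Γ ≠ []) (hΓ : VFG W Γ) (hA : Adm Γ) :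
    (1 / 2 : ℝ) • tot Γ ∈ W :=
  isNormingClosed_W.schreier _ (isSchreierFunctional_list h0 hΓ hA)

theorem filter_mem_W (p : ℕ+ → Prop) [DecidablePred p] {f : ℕ+ →₀ ℝ} (hf : f ∈ W) :
    f.filter p = 0 ∨ f.filter p ∈ W := by
  refine W_induction (P := fun f => f.filter p = 0 ∨ f.filter p ∈ W) ?_ ?_ ?_ ?_ hf
  · intro i
    by_cases h : p i
    · right; rw [Finsupp.filter_single_of_pos _ h]; exact isNormingClosed_W.unit i
    · left; exact Finsupp.filter_single_of_neg _ h
  · rintro f - (h | h)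
    · left; rw [Finsupp.filter_neg, h, neg_zero]
    · right; rw [Finsupp.filter_neg]; exact isNormingClosed_W.symm _ h
  · intro s l h0 hs hl hB
    exact ((isAlphaAverage_list (G := {f | f.filter p = 0 ∨ f.filter p ∈ W}) h0 hs
      (fun f hf => (hl f hf).2) hB).filter fun f hf => hf).imp_right avg_mem_W
  · intro Γ h0 hΓ hA
    obtain ⟨Δ, h1, h2, h3, h4⟩ := hΓ.filter (H := W) (p := p) fun f hf => hf.2
    rw [Finsupp.filter_smul, ← h2]
    by_cases h : Δ = []
    · left; simp [h]
    · right
      refine half_tot_mem_W h h1 fun q hq m hm => ?_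
      obtain ⟨r, hr, -, he⟩ := h4 q hq
      exact h3.trans (hA r hr m (support_filter_subset p _ (he ▸ hm)))

/-! ### Coordinate projections and almost norming functionals -/

theorem abs_ev_le {f : ℕ+ →₀ ℝ} (hf : f ∈ W) (x : ℕ+ →₀ ℝ) : |ev x f| ≤ normW x := by
  rw [← pairing_eq_ev]; exact abs_pairing_le_normW hf x

theorem normW_zero : normW 0 = 0 := by
  have := normW_smul 0 0
  simpa using this

theorem normW_neg (x : ℕ+ →₀ ℝ) : normW (-x) = normW x := by
  have := normW_smul (-1) x
  simpa using this

theorem normW_sub_le (x y : ℕ+ →₀ ℝ) : normW (x - y) ≤ normW x + normW y := by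
  rw [sub_eq_add_neg, ← normW_neg y]; exact normW_add_le _ _

theorem normW_le_of_abs {x : ℕ+ →₀ ℝ} {r : ℝ} (h : ∀ f ∈ W, |ev x f| ≤ r) : normW x ≤ r :=
  normW_le fun f hf => by rw [pairing_eq_ev]; exact (le_abs_self _).trans (h f hf)

theorem normW_filter_le (p : ℕ+ → Prop) [DecidablePred p] (x : ℕ+ →₀ ℝ) :
    normW (x.filter p) ≤ normW x :=
  normW_le_of_abs fun f hf => by
    rw [ev_filter]
    rcases filter_mem_W p hf with h | h
    · rw [h]; simpa using normW_nonneg x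
    · exact abs_ev_le h x

theorem abs_ev_tot_le {Γ : List ((ℕ+ →₀ ℝ) × ℕ)} (hΓ : VFG W Γ) (hA : Adm Γ) (x : ℕ+ →₀ ℝ) :
    |ev x (tot Γ)| ≤ 2 * normW x := by
  by_cases h0 : Γ = []
  · simpa [h0] using normW_nonneg x
  · have h := abs_ev_le (half_tot_mem_W h0 hΓ hA) x
    rw [map_smul, smul_eq_mul, abs_mul, abs_of_pos (by norm_num : (0 : ℝ) < 1 / 2)] at h
    linarith

theorem exists_mem_W_lt {x : ℕ+ →₀ ℝ} {r : ℝ} (hr : r < normW x) : ∃ f ∈ W, r < ev x f := by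
  by_contra! h
  exact hr.not_ge (normW_le fun f hf => by rw [pairing_eq_ev]; exact h f hf)

/-- A functional that almost norms `x` can be taken with support inside that of `x`. -/
theorem exists_mem_W_lt' {x : ℕ+ →₀ ℝ} {r : ℝ} (h0 : 0 ≤ r) (hr : r < normW x) :
    ∃ f ∈ W, r < ev x f ∧ f.support ⊆ x.support := by
  classical
  obtain ⟨f, hf, h⟩ := exists_mem_W_lt hr
  have he : ev x (f.filter (· ∈ x.support)) = ev x f := by
    rw [← ev_filter]
    congr 2
    ext i
    by_cases hi : x i = 0 <;> simp [hi]
  refine ⟨f.filter (· ∈ x.support), ?_, he ▸ h, ?_⟩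
  · refine (filter_mem_W _ hf).resolve_left fun h0' => ?_
    rw [h0', map_zero] at he
    linarith
  · rw [Finsupp.support_filter]
    exact fun i hi => (Finset.mem_filter.mp hi).2

/-! ### The upper estimate -/

theorem exists_append_cons_of_not_forall {α : Type*} (P : α → Prop) (l : List α) :
    (∀ a ∈ l, P a) ∨ ∃ l₁ a l₂, l = l₁ ++ a :: l₂ ∧ (∀ b ∈ l₁, P b) ∧ ¬ P a := by
  induction l with
  | nil => left; simp
  | cons a l ih =>
    by_cases ha : P a
    · rcases ih with h | ⟨l₁, b, l₂, rfl, h1, h2⟩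
      · left; simpa [ha] using h
      · right; exact ⟨a :: l₁, b, l₂, rfl, by simpa [ha] using h1, h2⟩
    · right; exact ⟨[], a, l, rfl, by simp, ha⟩

/-- `Z` is bounded by `D` under all admissible very fast growing lists with at most `N ≤ T` terms
and sizes at least `S N`. -/
def Controlled (S : ℕ → ℕ) (T : ℕ) (Z : ℕ+ →₀ ℝ) (D : ℝ) : Prop :=
  ∀ N ≤ T, ∀ Γ, VFG W Γ → Adm Γ → Γ.length ≤ N → (∀ p ∈ Γ, S N ≤ p.2) → |ev Z (tot Γ)| ≤ D

/-- The factor ½ of Schreier functionals makes the bound reproduce itself: a functional that meets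
`z` gives at most A + (B + D)/2, which 2A + D ≤ B turns into at most B. The bound on `Z` is
therefore not worsened by putting `z` in front. -/
theorem normW_add_le_of_controlled {S : ℕ → ℕ} {m T : ℕ} {z Z : ℕ+ →₀ ℝ} {A D B : ℝ}
    (hz : ∀ i ∈ z.support, (i : ℕ) ≤ m) (hZ : ∀ i ∈ Z.support, T < (i : ℕ)) (hmT : m ≤ T)
    (hST : S m ≤ T) (hA : normW z ≤ A) (hZB : normW Z ≤ B) (hD : Controlled S T Z D)
    (hB : 2 * A + D ≤ B) : normW (z + Z) ≤ B := by
  have hA0 := normW_nonneg z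
  have hB0 := normW_nonneg Z
  refine normW_le_of_abs fun f hf => ?_
  refine W_induction (P := fun f => |ev (z + Z : ℕ+ →₀ ℝ) f| ≤ B) ?_ ?_ ?_ ?_ hf
  · intro i
    have hD0 : 0 ≤ D := by simpa using hD 0 (Nat.zero_le _) [] VFG.nil (by simp [Adm]) (by simp) (by simp)
    rw [ev_add]
    by_cases hi : (i : ℕ) ≤ T
    · have h0 : ev Z (Finsupp.single i 1) = 0 := ev_eq_zero fun k hk => by
        obtain rfl : k = i := by simpa [Finsupp.single_apply, eq_comm] using hk
        by_contra h
        exact absurd (hZ k (by simpa using h)) (by omega)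
      rw [h0, add_zero]
      have := abs_ev_le (isNormingClosed_W.unit i) z
      linarith
    · have h0 : ev z (Finsupp.single i 1) = 0 := ev_eq_zero fun k hk => by
        obtain rfl : k = i := by simpa [Finsupp.single_apply, eq_comm] using hk
        by_contra h
        exact absurd (hz k (by simpa using h)) (by omega)
      rw [h0, zero_add]
      exact (abs_ev_le (isNormingClosed_W.unit i) Z).trans hZB
  · intro f _ h
    rwa [map_neg, abs_neg]
  · intro s l h0 hs hl hB'
    have hs0 : (0 : ℝ) < s := by
      have := List.length_pos_iff.mpr h0
      exact_mod_cast (by omega : 0 < s)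
    have hsum : |ev (z + Z : ℕ+ →₀ ℝ) l.sum| ≤ l.length * B := by
      clear h0 hs hB'
      induction l with
      | nil => simp
      | cons f l ih =>
        rw [List.sum_cons, map_add]
        have h1 := (hl f (by simp)).2
        have h2 := ih fun g hg => hl g (List.mem_cons_of_mem _ hg)
        calc _ ≤ B + l.length * B := (abs_add_le _ _).trans (add_le_add h1 h2)
          _ = _ := by push_cast [List.length_cons]; ring
    rw [map_smul, smul_eq_mul, abs_mul, abs_of_pos (by positivity), one_div, inv_mul_le_iff₀ hs0]
    refine hsum.trans ?_
    have : (l.length : ℝ) ≤ s := by exact_mod_cast hs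
    exact mul_le_mul_of_nonneg_right this (hB0.trans hZB)
  · intro Γ h0 hΓ hAdm
    have hΓ' : VFG W Γ := hΓ.mono fun f hf => hf.1
    have hW := half_tot_mem_W h0 hΓ' hAdm
    rw [ev_add]
    -- If some average meets the initial segment up to `m`, admissibility bounds the number of
    -- averages by `m`; otherwise `z` is not seen at all.
    by_cases htouch : ∃ p ∈ Γ, ∃ i ∈ p.1.support, (i : ℕ) ≤ m
    · obtain ⟨p, hp, i, hi, him⟩ := htouch
      have hlen : Γ.length ≤ m := (hAdm p hp i hi).trans him
      have hz1 : |ev z ((1 / 2 : ℝ) • tot Γ)| ≤ A := (abs_ev_le hW z).trans hA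
      have hZ1 : |ev Z (tot Γ)| ≤ B + D := by
        have hzero : ∀ Δ : List ((ℕ+ →₀ ℝ) × ℕ), (∀ q ∈ Δ, ∀ i ∈ q.1.support, (i : ℕ) ≤ T) →
            ev Z (tot Δ) = 0 := fun Δ hΔ => ev_tot_eq_zero fun q hq i hi => by
          by_contra hne
          exact absurd (hZ i (by simpa using hne)) (by have := hΔ q hq i hi; omega)
        have hD0 : 0 ≤ D := by
          simpa using hD 0 (Nat.zero_le _) [] VFG.nil (by simp [Adm]) (by simp) (by simp)
        -- Split at the first average that reaches beyond `T`. Those before it miss `Z`, it gives at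
        -- most `B` itself, and very fast growth forces the later sizes above `T ≥ S m`, where
        -- control applies.
        rcases exists_append_cons_of_not_forall
          (fun q : (ℕ+ →₀ ℝ) × ℕ => ∀ i ∈ q.1.support, (i : ℕ) ≤ T) Γ with h | ⟨Γ₁, q, Γ₂, he, h1, h2⟩
        · rw [hzero Γ h, abs_zero]; linarith
        · push Not at h2
          obtain ⟨k, hk, hkT⟩ := h2
          have hsub : (q :: Γ₂).Sublist Γ := by rw [he]; exact List.sublist_append_right _ _
          have hv2 := hΓ'.sublist hsub
          have hv3 : VFG W Γ₂ := hv2.sublist (List.sublist_cons_self _ _)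
          have ha3 : Adm Γ₂ := (hAdm.sublist hsub).sublist (List.sublist_cons_self _ _)
          have hc := hD m hmT Γ₂ hv3 ha3
            (((List.sublist_cons_self _ _).trans hsub).length_le.trans hlen) fun r hr => by
              have := ((List.pairwise_cons.mp hv2.2).1 r hr).2.2 k hk
              omega
          have hq := (abs_ev_le (avg_mem_W (hv2.1 q (by simp))) Z).trans hZB
          rw [he, tot_append, tot_cons, map_add, map_add, hzero Γ₁ h1, zero_add]
          exact (abs_add_le _ _).trans (add_le_add hq hc)
      calc _ ≤ A + 1 / 2 * (B + D) := by
            refine (abs_add_le _ _).trans (add_le_add hz1 ?_)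
            rw [map_smul, smul_eq_mul, abs_mul, abs_of_pos (by norm_num : (0 : ℝ) < 1 / 2)]
            linarith
        _ ≤ B := by linarith
    · push Not at htouch
      have h0 : ev z (tot Γ) = 0 := ev_tot_eq_zero fun q hq i hi => by
        by_contra hne
        exact absurd (hz i (by simpa using hne)) (by have := htouch q hq i hi; omega)
      rw [map_smul (ev z), h0, smul_zero, zero_add]
      exact (abs_ev_le hW Z).trans hZB

/-- A vector with support after `T`, norm at most `B`, controlled by `D`. -/
structure IsTail (S : ℕ → ℕ) (T : ℕ) (Z : ℕ+ →₀ ℝ) (B D : ℝ) : Prop where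
  support_lt : ∀ i ∈ Z.support, T < (i : ℕ)
  norm_le : normW Z ≤ B
  controlled : Controlled S T Z D

theorem isTail_zero (S : ℕ → ℕ) (T : ℕ) {B : ℝ} (hB : 0 ≤ B) : IsTail S T 0 B 0 :=
  ⟨by simp, by rwa [normW_zero], fun N _ Γ _ _ _ _ => by rw [ev_zero_left, abs_zero]⟩

/-- Only the control constant grows when a vector is put in front; the norm bound `B` stays. Hence
many vectors can be added as long as twice the individual norm bound plus the accumulated control
does not exceed `B`. -/
theorem IsTail.add {S : ℕ → ℕ} {T T₁ m : ℕ} {z Z : ℕ+ →₀ ℝ} {A B d D : ℝ}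
    (hZ : IsTail S T₁ Z B D) (hTz : ∀ i ∈ z.support, T < (i : ℕ)) (hzm : ∀ i ∈ z.support, (i : ℕ) ≤ m)
    (hT : T ≤ T₁) (hm : m ≤ T₁) (hS : S m ≤ T₁) (hA : normW z ≤ A) (hd : Controlled S T z d)
    (hB : 2 * A + D ≤ B) : IsTail S T (z + Z) B (d + D) := by
  refine ⟨fun i hi => ?_, normW_add_le_of_controlled hzm hZ.support_lt hm hS hA hZ.norm_le
    hZ.controlled hB, fun N hN Γ h1 h2 h3 h4 => ?_⟩
  · rcases Finset.mem_union.mp (Finsupp.support_add hi) with h | h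
    · exact hTz i h
    · exact hT.trans_lt (hZ.support_lt i h)
  · rw [ev_add]
    exact (abs_add_le _ _).trans (add_le_add (hd N hN Γ h1 h2 h3 h4)
      (hZ.controlled N (hN.trans hT) Γ h1 h2 h3 h4))

/-! ### The embedding of the finitely supported sequences -/

/-- The embedding of the finitely supported sequences into the completion. -/
noncomputable def toX : (ℕ+ →₀ ℝ) →ₗ[ℝ] XHalf :=
  (UniformSpace.Completion.toComplₗᵢ (𝕜 := ℝ) (E := C00)).toLinearMap

theorem norm_toX (x : ℕ+ →₀ ℝ) : ‖toX x‖ = normW x :=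
  (UniformSpace.Completion.toComplₗᵢ (𝕜 := ℝ) (E := C00)).norm_map x

theorem exists_norm_sub_toX_lt (x : XHalf) {ε : ℝ} (hε : 0 < ε) : ∃ u, ‖x - toX u‖ < ε := by
  obtain ⟨u, hu⟩ := (UniformSpace.Completion.denseRange_coe (α := C00)).exists_dist_lt x hε
  exact ⟨u, by rwa [dist_eq_norm] at hu⟩

/-! ### Truncations and bounded completeness -/

/-- The finite set of indices that are at most `m`. -/
def below (m : ℕ) : Finset ℕ+ := (Finset.range m).image Nat.succPNat

theorem mem_below {m : ℕ} {i : ℕ+} : i ∈ below m ↔ (i : ℕ) ≤ m := by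
  simp only [below, Finset.mem_image, Finset.mem_range]
  constructor
  · rintro ⟨k, hk, rfl⟩
    simpa using hk
  · intro h
    exact ⟨i.natPred, by have := PNat.natPred_add_one i; omega, PNat.succPNat_natPred i⟩

/-- The first `m` terms of a sequence of real numbers. -/
noncomputable def trunc (m : ℕ) (c : ℕ+ → ℝ) : ℕ+ →₀ ℝ :=
  Finsupp.onFinset (below m) (fun i => if (i : ℕ) ≤ m then c i else 0) fun i hi => by
    rw [mem_below]
    by_contra h
    simp [h] at hi

theorem trunc_apply (m : ℕ) (c : ℕ+ → ℝ) (i : ℕ+) :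
    trunc m c i = if (i : ℕ) ≤ m then c i else 0 := rfl

theorem normW_le_sum {s : Finset ℕ+} {x : ℕ+ →₀ ℝ} (hs : x.support ⊆ s) :
    normW x ≤ ∑ i ∈ s, |x i| := by
  refine normW_le fun f hf => ?_
  rw [pairing_eq_sum]
  calc ∑ i ∈ x.support, f i * x i ≤ ∑ i ∈ x.support, |x i| := by
        refine Finset.sum_le_sum fun i _ => (le_abs_self _).trans ?_
        rw [abs_mul]
        exact mul_le_of_le_one_left (abs_nonneg _) (abs_coeff_le_one hf i)
    _ ≤ _ := Finset.sum_le_sum_of_subset_of_nonneg hs fun _ _ _ => abs_nonneg _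

/-- An average of successive functionals with values at least ε again has value at least ε, so large
sizes come for free. -/
theorem exists_average_of_forall {c : ℕ+ → ℝ} {ε : ℝ}
    (h : ∀ M : ℕ, ∃ f ∈ W, (∀ i ∈ f.support, M < (i : ℕ)) ∧ ε ≤ ev c f) {s : ℕ} (hs : 0 < s) (M : ℕ) :
    ∃ a, IsAlphaAverage W s a ∧ (∀ i ∈ a.support, M < (i : ℕ)) ∧ ε ≤ ev c a := by
  have key : ∀ s M : ℕ, ∃ l : List (ℕ+ →₀ ℝ), l.length = s ∧ l.Pairwise Before ∧
      (∀ f ∈ l, f ∈ W ∧ ∀ i ∈ f.support, M < (i : ℕ)) ∧ s * ε ≤ ev c l.sum := by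
    intro s
    induction s with
    | zero => intro M; exact ⟨[], by simp⟩
    | succ s ih =>
      intro M
      obtain ⟨f, hf, hfM, hfε⟩ := h M
      obtain ⟨m, hm⟩ := exists_support_le f
      obtain ⟨l, h1, h2, h3, h4⟩ := ih (max m M)
      refine ⟨f :: l, by simp [h1], List.pairwise_cons.mpr ⟨fun g hg => ?_, h2⟩, ?_, ?_⟩
      · exact Before.of_le hm fun i hi => (le_max_left m M).trans_lt ((h3 g hg).2 i hi)
      · intro g hg
        rcases List.mem_cons.mp hg with rfl | hg
        · exact ⟨hf, hfM⟩
        · exact ⟨(h3 g hg).1, fun i hi => (le_max_right m M).trans_lt ((h3 g hg).2 i hi)⟩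
      · rw [List.sum_cons, map_add]
        push_cast
        linarith
  obtain ⟨l, h1, h2, h3, h4⟩ := key s M
  have h0 : l ≠ [] := by rintro rfl; simp at h1; omega
  have hs' : (0 : ℝ) < s := by exact_mod_cast hs
  refine ⟨_, isAlphaAverage_list h0 h1.le (fun f hf => (h3 f hf).1) h2, fun i hi => ?_, ?_⟩
  · have hi' : i ∈ l.sum.support := Finsupp.support_smul hi
    by_contra hiM
    refine (Finsupp.mem_support_iff.mp hi') ?_
    have h3' : ∀ f ∈ l, f i = 0 := fun f hf => by
      by_contra hne
      exact hiM ((h3 f hf).2 i (by simpa using hne))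
    clear * - h3'
    induction l with
    | nil => rfl
    | cons f l ih =>
      rw [List.sum_cons, Finsupp.add_apply, h3' f (by simp),
        ih fun g hg => h3' g (List.mem_cons_of_mem _ hg), add_zero]
  · rw [map_smul, smul_eq_mul, one_div, le_inv_mul_iff₀ hs']
    exact h4

theorem exists_vfg_of_forall {c : ℕ+ → ℝ} {ε : ℝ}
    (h : ∀ M : ℕ, ∃ f ∈ W, (∀ i ∈ f.support, M < (i : ℕ)) ∧ ε ≤ ev c f) (k : ℕ) :
    ∀ M : ℕ, ∃ Γ, VFG W Γ ∧ Γ.length = k ∧ (∀ p ∈ Γ, M < p.2 ∧ ∀ i ∈ p.1.support, M < (i : ℕ)) ∧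
      k * ε ≤ ev c (tot Γ) := by
  induction k with
  | zero => intro M; exact ⟨[], VFG.nil, by simp⟩
  | succ k ih =>
    intro M
    obtain ⟨a, ha, haM, haε⟩ := exists_average_of_forall h M.succ_pos M
    obtain ⟨m, hm⟩ := exists_support_le a
    obtain ⟨Γ, h1, h2, h3, h4⟩ := ih (max (M + 1) m)
    refine ⟨[(a, M + 1)] ++ Γ, VFG.append (T := max (M + 1) m) ⟨by simpa using ha, by simp⟩ h1
      ?_ h3, by simp [h2], ?_, ?_⟩
    · intro p hp
      obtain rfl := List.mem_singleton.mp hp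
      exact ⟨le_max_left _ _, fun i hi => (hm i hi).trans (le_max_right _ _)⟩
    · intro p hp
      rcases List.mem_append.mp hp with hp | hp
      · obtain rfl := List.mem_singleton.mp hp
        exact ⟨M.lt_succ_self, haM⟩
      · have := h3 p hp
        exact ⟨by omega, fun i hi => by have := this.2 i hi; omega⟩
    · rw [tot_append, map_add]
      simp only [tot_cons, tot_nil, add_zero]
      push_cast
      linarith

/-- The unit vector basis is boundedly complete. -/
theorem exists_normW_trunc_sub_le {c : ℕ+ → ℝ} {K : ℝ} (hK : ∀ m, normW (trunc m c) ≤ K) {ε : ℝ}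
    (hε : 0 < ε) : ∃ M, ∀ m, M ≤ m → normW (trunc m c - trunc M c) ≤ ε := by
  by_contra! hcon
  -- If the truncations were not Cauchy, functionals arbitrarily far out would take values at least
  -- ε on `c`.
  have h : ∀ M : ℕ, ∃ f ∈ W, (∀ i ∈ f.support, M < (i : ℕ)) ∧ ε ≤ ev c f := by
    intro M
    obtain ⟨m, hm, hlt⟩ := hcon M
    obtain ⟨f, hf, h1, h2⟩ := exists_mem_W_lt' hε.le hlt
    have hval : ∀ i ∈ f.support, M < (i : ℕ) ∧ (i : ℕ) ≤ m := by
      intro i hi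
      have := Finsupp.mem_support_iff.mp (h2 hi)
      rw [Finsupp.sub_apply, trunc_apply, trunc_apply] at this
      by_contra hcon
      apply this
      by_cases h : (i : ℕ) ≤ M
      · simp [h, h.trans hm]
      · simp [h, show ¬ (i : ℕ) ≤ m by omega]
    refine ⟨f, hf, fun i hi => (hval i hi).1, ?_⟩
    rw [ev_congr (c' := (trunc m c - trunc M c : ℕ+ →₀ ℝ))]
    · exact h1.le
    · intro i hi
      rw [Finsupp.sub_apply, trunc_apply, trunc_apply, if_pos (hval i hi).2,
        if_neg (by have := (hval i hi).1; omega), sub_zero]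
  -- `k` averages supported beyond `k` form an admissible list with value at least kε > 2K, while
  -- half its sum lies in `W` and is at most `K` on truncations.
  obtain ⟨k, hk⟩ := exists_nat_gt (2 * K / ε)
  obtain ⟨Γ, h1, h2, h3, h4⟩ := exists_vfg_of_forall h k k
  obtain ⟨m, hm⟩ := exists_support_le (tot Γ)
  have h5 := abs_ev_tot_le h1 (fun p hp i hi => h2 ▸ ((h3 p hp).2 i hi).le) (trunc m c)
  have h6 : ev (trunc m c) (tot Γ) = ev c (tot Γ) := ev_congr fun i hi => by
    rw [trunc_apply, if_pos (hm i hi)]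
  rw [h6] at h5
  rw [div_lt_iff₀ hε] at hk
  have := le_abs_self (ev c (tot Γ))
  have := hK m
  linarith

theorem exists_tendsto_of_bounded (𝒰 : Ultrafilter ℕ) {r : ℕ → ℝ} {K : ℝ} (h : ∀ j, |r j| ≤ K) :
    ∃ c, Tendsto r 𝒰 (𝓝 c) := by
  obtain ⟨c, -, hc⟩ := (isCompact_Icc (a := -K) (b := K)).ultrafilter_le_nhds (𝒰.map r)
    (le_principal_iff.mpr (Filter.mem_map.mpr (univ_mem' fun j => abs_le.mp (h j))))
  exact ⟨c, hc⟩

/-- Along an ultrafilter, a bounded sequence differs by a fixed vector from a sequence whose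
initial segments are small. -/
theorem exists_eventually_normW_filter_le (𝒰 : Ultrafilter ℕ) {u : ℕ → ℕ+ →₀ ℝ} {K : ℝ}
    (hK : ∀ j, normW (u j) ≤ K) {ε : ℝ} (hε : 0 < ε) :
    ∃ a : ℕ+ →₀ ℝ, ∀ m : ℕ, ∀ᶠ j in (𝒰 : Filter ℕ),
      normW ((u j - a).filter fun i : ℕ+ => (i : ℕ) ≤ m) ≤ ε := by
  have hc : ∀ i, ∃ c, Tendsto (fun j => u j i) 𝒰 (𝓝 c) := fun i =>
    exists_tendsto_of_bounded 𝒰 fun j => (abs_apply_le_normW _ i).trans (hK j)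
  choose c hc using hc
  have hnear : ∀ (m : ℕ) (η : ℝ), 0 < η → ∀ᶠ j in (𝒰 : Filter ℕ),
      normW (((u j).filter fun i : ℕ+ => (i : ℕ) ≤ m) - trunc m c) ≤ η := by
    intro m η hη
    have ht : Tendsto (fun j => ∑ i ∈ below m, |u j i - c i|) 𝒰 (𝓝 0) := by
      have : Tendsto (fun j => ∑ i ∈ below m, |u j i - c i|) 𝒰 (𝓝 (∑ i ∈ below m, |c i - c i|)) :=
        tendsto_finsetSum _ fun i _ => ((hc i).sub_const _).abs
      simpa using this
    filter_upwards [ht.eventually_le_const hη] with j hj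
    refine (normW_le_sum (s := below m) fun i hi => ?_).trans ((Finset.sum_le_sum fun i hi => ?_).trans hj)
    · rw [mem_below]
      by_contra h
      simp [trunc_apply, h] at hi
    · have := mem_below.mp hi
      simp [trunc_apply, this]
  -- The coordinatewise limit `c` has bounded truncations, so by bounded completeness one finite
  -- truncation can stand in for all of it.
  have hKc : ∀ m, normW (trunc m c) ≤ K := by
    intro m
    refine le_of_forall_pos_le_add fun η hη => ?_
    obtain ⟨j, hj⟩ := (hnear m η hη).exists
    have h1 := (normW_filter_le (fun i : ℕ+ => (i : ℕ) ≤ m) (u j)).trans (hK j)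
    have h2 := normW_sub_le ((u j).filter fun i : ℕ+ => (i : ℕ) ≤ m)
      (((u j).filter fun i : ℕ+ => (i : ℕ) ≤ m) - trunc m c)
    rw [sub_sub_cancel] at h2
    linarith
  obtain ⟨M, hM⟩ := exists_normW_trunc_sub_le hKc (half_pos hε)
  refine ⟨trunc M c, fun m => ?_⟩
  filter_upwards [hnear (max m M) (ε / 2) (half_pos hε)] with j hj
  have he : (u j - trunc M c).filter (fun i : ℕ+ => (i : ℕ) ≤ m) =
      ((((u j).filter fun i : ℕ+ => (i : ℕ) ≤ max m M) - trunc (max m M) c) +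
        (trunc (max m M) c - trunc M c)).filter fun i : ℕ+ => (i : ℕ) ≤ m := by
    ext i
    by_cases hi : (i : ℕ) ≤ m
    · simp [hi]
    · simp [hi]
  rw [he]
  refine (normW_filter_le _ _).trans ((normW_add_le _ _).trans ?_)
  have := hM (max m M) (le_max_right _ _)
  linarith

/-! ### Iterated limits -/

/-- `P (j₁, …, jₙ)` holds for almost all `j₁`, almost all `j₂`, and so on. -/
def IterEventually (l : Filter ℕ) : (n : ℕ) → ((Fin n → ℕ) → Prop) → Prop
  | 0, P => P Fin.elim0
  | n + 1, P => ∀ᶠ j in l, IterEventually l n fun t => P (Fin.cons j t)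

theorem IterEventually.mono {l : Filter ℕ} {n : ℕ} {P Q : (Fin n → ℕ) → Prop}
    (h : ∀ j, P j → Q j) (hP : IterEventually l n P) : IterEventually l n Q := by
  induction n with
  | zero => exact h _ hP
  | succ n ih => exact Eventually.mono hP fun j hj => ih (fun t => h _) hj

theorem IterEventually.and {l : Filter ℕ} {n : ℕ} {P Q : (Fin n → ℕ) → Prop}
    (hP : IterEventually l n P) (hQ : IterEventually l n Q) :
    IterEventually l n fun j => P j ∧ Q j := by
  induction n with
  | zero => exact ⟨hP, hQ⟩
  | succ n ih => exact (Eventually.and hP hQ).mono fun j hj => ih hj.1 hj.2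

theorem IterEventually.exists {l : Filter ℕ} [l.NeBot] {n : ℕ} {P : (Fin n → ℕ) → Prop}
    (hP : IterEventually l n P) : ∃ j, P j := by
  induction n with
  | zero => exact ⟨_, hP⟩
  | succ n ih =>
    obtain ⟨j, hj⟩ := Eventually.exists hP
    obtain ⟨t, ht⟩ := ih hj
    exact ⟨_, ht⟩

/-- This transfers the given iterated limits to an ultrafilter, along which all the auxiliary limits
exist as well. -/
theorem HasIteratedLimit.iterEventually {l : Filter ℕ} (hl : l ≤ atTop) {n : ℕ}
    {F : (Fin n → ℕ) → ℝ} {L : ℝ} (h : HasIteratedLimit n F L) {ε : ℝ} (hε : 0 < ε) :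
    IterEventually l n fun j => |F j - L| < ε := by
  induction n generalizing L ε with
  | zero =>
    have : F Fin.elim0 = L := h
    simpa [IterEventually, this] using hε
  | succ n ih =>
    obtain ⟨G, h1, h2⟩ := h
    have h3 := (Metric.tendsto_nhds.mp h2 (ε / 2) (half_pos hε))
    refine Eventually.mono ((h1.and h3).filter_mono hl) fun j hj => ?_
    refine (ih hj.1 (half_pos hε)).mono fun t ht => ?_
    have h4 := hj.2
    rw [Real.dist_eq] at h4
    calc _ ≤ |F (Fin.cons j t) - G j| + |G j - L| := abs_sub_le _ _ _
      _ < ε := by linarith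

/-! ### Upper and lower estimates for sequences with small initial segments -/

theorem filter_le_add_filter_lt (T : ℕ) (y : ℕ+ →₀ ℝ) :
    (y.filter fun i : ℕ+ => (i : ℕ) ≤ T) + (y.filter fun i : ℕ+ => T < (i : ℕ)) = y := by
  ext i
  by_cases h : (i : ℕ) ≤ T
  · simp [h, not_lt.mpr h]
  · simp [h, not_le.mp h]

theorem mem_support_filter {p : ℕ+ → Prop} [DecidablePred p] {y : ℕ+ →₀ ℝ} {i : ℕ+}
    (h : i ∈ (y.filter p).support) : p i := by
  rw [Finsupp.support_filter] at h
  exact (Finset.mem_filter.mp h).2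

theorem normW_sub_filter_lt {T : ℕ} {y : ℕ+ →₀ ℝ} {ε : ℝ}
    (h : normW (y.filter fun i : ℕ+ => (i : ℕ) ≤ T) ≤ ε) :
    normW (y - y.filter fun i : ℕ+ => T < (i : ℕ)) ≤ ε := by
  rwa [← eq_sub_of_add_eq (filter_le_add_filter_lt T y)]

/-- The loss is 2ε because only half of an admissible sum belongs to `W`. -/
theorem Controlled.filter_lt {S : ℕ → ℕ} {T : ℕ} {y : ℕ+ →₀ ℝ} {d ε : ℝ}
    (hd : Controlled S T y d) (h : normW (y.filter fun i : ℕ+ => (i : ℕ) ≤ T) ≤ ε) :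
    Controlled S T (y.filter fun i : ℕ+ => T < (i : ℕ)) (d + 2 * ε) := by
  intro N hN Γ h1 h2 h3 h4
  rw [eq_sub_of_add_eq' (filter_le_add_filter_lt T y), ev_sub]
  refine (abs_sub _ _).trans (add_le_add (hd N hN Γ h1 h2 h3 h4) ?_)
  exact (abs_ev_tot_le h1 h2 _).trans (by linarith)

/-- The outermost index is fixed first; its vector then dictates how far out all the remaining ones
must start. Induction treats these with the new threshold, and `IsTail.add` puts the first vector in
front. -/
theorem iterEventually_exists_isTail {l : Filter ℕ} {S : ℕ → ℕ} {A ε B : ℝ} (hA : 0 ≤ A)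
    (hε : 0 ≤ ε) {n : ℕ} {y : Fin n → ℕ → ℕ+ →₀ ℝ} {d : Fin n → ℝ} (hd : ∀ i, 0 ≤ d i)
    (h1 : ∀ i, ∀ m : ℕ, ∀ᶠ j in l, normW ((y i j).filter fun k : ℕ+ => (k : ℕ) ≤ m) ≤ ε)
    (h2 : ∀ i, ∀ᶠ j in l, normW (y i j) ≤ A)
    (h3 : ∀ i T, ∀ᶠ j in l, Controlled S T (y i j) (d i))
    (hB : 2 * A + ∑ i, (d i + 2 * ε) ≤ B) (T : ℕ) :
    IterEventually l n fun j => ∃ Z, IsTail S T Z B (∑ i, (d i + 2 * ε)) ∧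
      normW (∑ i, y i (j i) - Z) ≤ n * ε := by
  induction n generalizing T with
  | zero =>
    refine ⟨0, ?_, by simp [normW_zero]⟩
    simpa using isTail_zero S T (B := B) (by simp at hB; linarith)
  | succ n ih =>
    rw [Fin.sum_univ_succ] at hB ⊢
    have hd0 := hd 0
    have hB' : 2 * A + ∑ i : Fin n, (d i.succ + 2 * ε) ≤ B := by linarith
    filter_upwards [h1 0 T, h2 0, h3 0 T] with j hj1 hj2 hj3
    obtain ⟨m, hm⟩ := exists_support_le ((y 0 j).filter fun i : ℕ+ => T < (i : ℕ))
    refine (ih (y := fun i => y i.succ) (d := fun i => d i.succ) (fun i => hd _) (fun i => h1 _)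
      (fun i => h2 _) (fun i => h3 _) hB' (max T (max m (S m)))).mono fun t ⟨Z, hZ, hZ'⟩ => ?_
    refine ⟨(y 0 j).filter (fun i : ℕ+ => T < (i : ℕ)) + Z, ?_, ?_⟩
    · exact hZ.add (m := m) (fun i hi => mem_support_filter hi) hm (le_max_left _ _)
        ((le_max_left _ _).trans (le_max_right _ _)) ((le_max_right _ _).trans (le_max_right _ _))
        ((normW_filter_le _ _).trans hj2) (hj3.filter_lt hj1) hB'
    · rw [Fin.sum_univ_succ]
      simp only [Fin.cons_zero, Fin.cons_succ]
      rw [add_sub_add_comm]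
      refine (normW_add_le _ _).trans ?_
      have := normW_sub_filter_lt hj1
      push_cast
      linarith

theorem normW_left_le {T : ℕ} {z Z : ℕ+ →₀ ℝ} (hz : ∀ i ∈ z.support, (i : ℕ) ≤ T)
    (hZ : ∀ i ∈ Z.support, T < (i : ℕ)) : normW z ≤ normW (z + Z) := by
  have h : z = (z + Z).filter fun i : ℕ+ => (i : ℕ) ≤ T := by
    ext i
    by_cases hi : (i : ℕ) ≤ T
    · have : Z i = 0 := by
        by_contra h
        exact absurd (hZ i (by simpa using h)) (by omega)
      simp [hi, this]
    · have : z i = 0 := by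
        by_contra h
        exact absurd (hz i (by simpa using h)) hi
      simp [hi, this]
  conv_lhs => rw [h]
  exact normW_filter_le _ _

theorem normW_right_le {T : ℕ} {z Z : ℕ+ →₀ ℝ} (hz : ∀ i ∈ z.support, (i : ℕ) ≤ T)
    (hZ : ∀ i ∈ Z.support, T < (i : ℕ)) : normW Z ≤ normW (z + Z) := by
  have h : Z = (z + Z).filter fun i : ℕ+ => T < (i : ℕ) := by
    ext i
    by_cases hi : (i : ℕ) ≤ T
    · have : Z i = 0 := by
        by_contra h
        exact absurd (hZ i (by simpa using h)) (by omega)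
      simp [not_lt.mpr hi, this]
    · have : z i = 0 := by
        by_contra h
        exact absurd (hz i (by simpa using h)) hi
      simp [not_le.mp hi, this]
  conv_lhs => rw [h]
  exact normW_filter_le _ _

theorem IsAlphaAverage.neg {s : ℕ} {a : ℕ+ →₀ ℝ} (h : IsAlphaAverage W s a) :
    IsAlphaAverage W s (-a) := by
  obtain ⟨d, h1, h2, f, hf, hB, rfl⟩ := h
  refine ⟨d, h1, h2, fun i => -f i, fun i => isNormingClosed_W.symm _ (hf i), fun i j hij => ?_, ?_⟩
  · exact (hB i j hij).mono (by simp) (by simp)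
  · rw [Finset.sum_neg_distrib, smul_neg]

/-- Changing all signs keeps sizes and supports. Positive values are needed so that contributions of
different vectors add up instead of cancelling. -/
theorem VFG.exists_abs_le {Γ : List ((ℕ+ →₀ ℝ) × ℕ)} (h : VFG W Γ) (hA : Adm Γ) (x : ℕ+ →₀ ℝ) :
    ∃ Δ, VFG W Δ ∧ Adm Δ ∧ Δ.length ≤ Γ.length ∧ (∀ p ∈ Δ, ∃ q ∈ Γ, p.2 = q.2) ∧
      |ev x (tot Γ)| ≤ ev x (tot Δ) := by
  rcases le_total 0 (ev x (tot Γ)) with h0 | h0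
  · exact ⟨Γ, h, hA, le_rfl, fun p hp => ⟨p, hp, rfl⟩, (abs_of_nonneg h0).le⟩
  · have hmem : ∀ p ∈ Γ.map (fun q => (-q.1, q.2)), ∃ q ∈ Γ, p.1 = -q.1 ∧ p.2 = q.2 := by
      intro p hp
      obtain ⟨q, hq, rfl⟩ := List.mem_map.mp hp
      exact ⟨q, hq, rfl, rfl⟩
    refine ⟨Γ.map fun q => (-q.1, q.2), ⟨fun p hp => ?_, ?_⟩, fun p hp m hm => ?_, by simp,
      fun p hp => ?_, ?_⟩
    · obtain ⟨q, hq, h1, h2⟩ := hmem p hp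
      rw [h1, h2]
      exact (h.1 q hq).neg
    · exact List.pairwise_map.mpr (h.2.imp fun hpq => ⟨hpq.1.mono (by simp) (by simp), hpq.2.1,
        by simpa using hpq.2.2⟩)
    · obtain ⟨q, hq, h1, -⟩ := hmem p hp
      rw [List.length_map]
      exact hA q hq m (by simpa [h1] using hm)
    · obtain ⟨q, hq, -, h2⟩ := hmem p hp
      exact ⟨q, hq, h2⟩
    · have : tot (Γ.map fun q => (-q.1, q.2)) = -tot Γ := by
        clear * -
        induction Γ with
        | nil => simp
        | cons p Γ ih => rw [List.map_cons, tot_cons, tot_cons, ih, neg_add]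
      rw [this, map_neg, abs_of_nonpos h0]

/-- The lists for the individual vectors concatenate: each new list can be taken with supports and
sizes beyond all earlier supports and sizes. Their lengths stay bounded by the `N i`, so starting
far enough out makes the joint list admissible. -/
theorem iterEventually_exists_vfg {l : Filter ℕ} {ε : ℝ} {n : ℕ} {y : Fin n → ℕ → ℕ+ →₀ ℝ}
    {e a : Fin n → ℝ} {N : Fin n → ℕ}
    (h1 : ∀ i, ∀ m : ℕ, ∀ᶠ j in l, normW ((y i j).filter fun k : ℕ+ => (k : ℕ) ≤ m) ≤ ε)
    (h2 : ∀ i, ∀ᶠ j in l, a i ≤ normW (y i j))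
    (h3 : ∀ i, ∀ s : ℕ, ∀ᶠ j in l, ∃ Γ, VFG W Γ ∧ Adm Γ ∧ Γ.length ≤ N i ∧ (∀ p ∈ Γ, s ≤ p.2) ∧
      e i < |ev (y i j) (tot Γ)|) (T : ℕ) :
    IterEventually l n fun j => ∃ Z : ℕ+ →₀ ℝ, (∀ i ∈ Z.support, T < (i : ℕ)) ∧
      normW (∑ i, y i (j i) - Z) ≤ n * ε ∧ (∀ i, a i - ε ≤ normW Z) ∧
      ∃ Γ, VFG W Γ ∧ Γ.length ≤ ∑ i, N i ∧ (∀ p ∈ Γ, T < p.2 ∧ ∀ i ∈ p.1.support, T < (i : ℕ)) ∧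
        ∑ i, (e i - 2 * ε) ≤ ev Z (tot Γ) := by
  induction n generalizing T with
  | zero =>
    exact ⟨0, by simp, by simp [normW_zero], fun i => i.elim0, [], VFG.nil, by simp, by simp, by simp⟩
  | succ n ih =>
    filter_upwards [h1 0 T, h2 0, h3 0 (T + 1)] with j hj1 hj2 ⟨Γ₀, g1, g2, g3, g4, g5⟩
    obtain ⟨Γ₁, v1, v2, v3, v4, v5⟩ := g1.exists_abs_le g2 (y 0 j)
    obtain ⟨Δ, w1, w2, w3, w4⟩ := v1.filter (p := fun i : ℕ+ => T < (i : ℕ)) fun f hf => filter_mem_W _ hf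
    have hΔ : ∀ p ∈ Δ, T < p.2 ∧ ∀ i ∈ p.1.support, T < (i : ℕ) := by
      intro p hp
      obtain ⟨q, hq, hq2, hq1⟩ := w4 p hp
      obtain ⟨r, hr, hr2⟩ := v4 q hq
      have := g4 r hr
      exact ⟨by omega, fun i hi => mem_support_filter (p := fun i : ℕ+ => T < (i : ℕ)) (hq1 ▸ hi)⟩
    set z := (y 0 j).filter fun i : ℕ+ => T < (i : ℕ) with hz
    have hzy : normW (y 0 j - z) ≤ ε := normW_sub_filter_lt hj1
    obtain ⟨m, hm⟩ := exists_support_le z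
    obtain ⟨m', hm'⟩ : ∃ m' : ℕ, ∀ p ∈ Δ, p.2 ≤ m' ∧ ∀ i ∈ p.1.support, (i : ℕ) ≤ m' := by
      clear * -
      induction Δ with
      | nil => exact ⟨0, by simp⟩
      | cons p Δ ih =>
        obtain ⟨k, hk⟩ := ih
        obtain ⟨k', hk'⟩ := exists_support_le p.1
        refine ⟨max k (max k' p.2), fun q hq => ?_⟩
        rcases List.mem_cons.mp hq with rfl | hq
        · exact ⟨by omega, fun i hi => by have := hk' i hi; omega⟩
        · exact ⟨by have := (hk q hq).1; omega, fun i hi => by have := (hk q hq).2 i hi; omega⟩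
    refine (ih (y := fun i => y i.succ) (e := fun i => e i.succ) (a := fun i => a i.succ)
      (N := fun i => N i.succ) (fun i => h1 _) (fun i => h2 _) (fun i => h3 _)
      (max T (max m m'))).mono fun t ⟨Z, z1, z2, z3, Γ, c1, c2, c3, c4⟩ => ?_
    have hzT : ∀ i ∈ z.support, (i : ℕ) ≤ max T (max m m') := fun i hi => by
      have := hm i hi; omega
    have hΔT : ∀ p ∈ Δ, p.2 ≤ max T (max m m') ∧ ∀ i ∈ p.1.support, (i : ℕ) ≤ max T (max m m') :=
      fun p hp => ⟨by have := (hm' p hp).1; omega, fun i hi => by have := (hm' p hp).2 i hi; omega⟩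
    refine ⟨z + Z, fun i hi => ?_, ?_, fun i => ?_, Δ ++ Γ, w1.append c1 hΔT c3, ?_, fun p hp => ?_, ?_⟩
    · rcases Finset.mem_union.mp (Finsupp.support_add hi) with h | h
      · exact mem_support_filter (p := fun i : ℕ+ => T < (i : ℕ)) h
      · have := z1 i h; omega
    · rw [Fin.sum_univ_succ]
      simp only [Fin.cons_zero, Fin.cons_succ]
      rw [add_sub_add_comm]
      refine (normW_add_le _ _).trans ?_
      push_cast
      linarith
    · refine Fin.cases ?_ (fun i => ?_) i
      · have h5 := normW_left_le hzT z1
        have h6 := normW_add_le (y 0 j - z) z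
        rw [sub_add_cancel] at h6
        linarith
      · exact (z3 i).trans (normW_right_le hzT z1)
    · rw [List.length_append, Fin.sum_univ_succ]
      omega
    · rcases List.mem_append.mp hp with h | h
      · exact hΔ p h
      · have := c3 p h
        exact ⟨by omega, fun i hi => by have := this.2 i hi; omega⟩
    · have e1 : ev z (tot Γ) = 0 := ev_tot_eq_zero fun p hp i hi => by
        by_contra hne
        have := hzT i (by simpa using hne)
        have := (c3 p hp).2 i hi
        omega
      have e2 : ev Z (tot Δ) = 0 := ev_tot_eq_zero fun p hp i hi => by
        by_contra hne
        have := z1 i (by simpa using hne)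
        have := (hΔT p hp).2 i hi
        omega
      have e3 : e 0 - 2 * ε ≤ ev z (tot Δ) := by
        rw [w2, ← ev_filter]
        have e4 : (z.filter fun i : ℕ+ => T < (i : ℕ)) = y 0 j - ((y 0 j).filter fun i : ℕ+ => (i : ℕ) ≤ T) := by
          rw [← eq_sub_of_add_eq' (filter_le_add_filter_lt T (y 0 j)), hz]
          ext i
          by_cases h : T < (i : ℕ) <;> simp [h]
        rw [e4, ev_sub]
        have e5 := (abs_le.mp ((abs_ev_tot_le v1 v2 _).trans (mul_le_mul_of_nonneg_left hj1 (by norm_num)))).2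
        linarith
      rw [ev_add, tot_append, map_add, map_add, e1, e2, Fin.sum_univ_succ]
      linarith

/-! ### Asymptotic symmetry -/

/-- The asymptotic index of a sequence: lists of `α`-averages of bounded length and sizes tending to
infinity do almost as well as `δ` on the sequence, and not better. -/
theorem exists_index (𝒰 : Ultrafilter ℕ) {y : ℕ → ℕ+ →₀ ℝ} {K : ℝ} (hK : ∀ j, normW (y j) ≤ K)
    {η : ℝ} (hη : 0 < η) : ∃ δ : ℝ, 0 ≤ δ + η ∧
      (∃ N : ℕ, ∀ s : ℕ, ∀ᶠ j in (𝒰 : Filter ℕ), ∃ Γ, VFG W Γ ∧ Adm Γ ∧ Γ.length ≤ N ∧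
        (∀ p ∈ Γ, s ≤ p.2) ∧ δ - η < |ev (y j) (tot Γ)|) ∧
      ∀ N : ℕ, ∃ s : ℕ, ∀ᶠ j in (𝒰 : Filter ℕ), ∀ Γ, VFG W Γ → Adm Γ → Γ.length ≤ N →
        (∀ p ∈ Γ, s ≤ p.2) → |ev (y j) (tot Γ)| ≤ δ + η := by
  set E : Set ℝ := {d | ∃ N : ℕ, ∀ s : ℕ, ∀ᶠ j in (𝒰 : Filter ℕ), ∃ Γ, VFG W Γ ∧ Adm Γ ∧
    Γ.length ≤ N ∧ (∀ p ∈ Γ, s ≤ p.2) ∧ d < |ev (y j) (tot Γ)|} with hE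
  have hbdd : BddAbove E := by
    refine ⟨2 * K, fun d ⟨N, hN⟩ => ?_⟩
    obtain ⟨j, Γ, h1, h2, -, -, h3⟩ := (hN 0).exists
    have := abs_ev_tot_le h1 h2 (y j)
    have := hK j
    linarith
  -- The empty list has value 0, which keeps the supremum of `E` from being negative.
  have hneg : ∀ d < 0, d ∈ E := fun d hd => ⟨0, fun s => Eventually.of_forall fun j =>
    ⟨[], VFG.nil, by simp [Adm], by simp, by simp, by simpa using hd⟩⟩
  have hne : E.Nonempty := ⟨-1, hneg _ (by norm_num)⟩
  refine ⟨sSup E, ?_, ?_, fun N => ?_⟩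
  · have := le_csSup hbdd (hneg (-η) (by linarith))
    linarith
  · obtain ⟨d, ⟨N, hN⟩, hd⟩ := exists_lt_of_lt_csSup hne (sub_lt_self (sSup E) hη)
    refine ⟨N, fun s => (hN s).mono ?_⟩
    rintro j ⟨Γ, h1, h2, h3, h4, h5⟩
    exact ⟨Γ, h1, h2, h3, h4, hd.trans h5⟩
  -- Along an ultrafilter, what fails to hold eventually has a negation that does hold eventually;
  -- this would put a number above the supremum into `E`.
  · by_contra! hcon
    have : sSup E + η ∈ E := ⟨N, fun s => hcon s⟩
    have := le_csSup hbdd this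
    linarith

theorem exists_upper_bound {l : Filter ℕ} [l.NeBot] {S : ℕ → ℕ} {A ε B : ℝ}
    (hε : 0 ≤ ε) {n : ℕ} {y : Fin n → ℕ → ℕ+ →₀ ℝ} {d : Fin n → ℝ} (hd : ∀ i, 0 ≤ d i)
    (h1 : ∀ i, ∀ m : ℕ, ∀ᶠ j in l, normW ((y i j).filter fun k : ℕ+ => (k : ℕ) ≤ m) ≤ ε)
    (h2 : ∀ i, ∀ᶠ j in l, normW (y i j) ≤ A)
    (h3 : ∀ i T, ∀ᶠ j in l, Controlled S T (y i j) (d i))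
    (hB : 2 * A + ∑ i, (d i + 2 * ε) ≤ B) {w : ℕ+ →₀ ℝ} (hw : normW w ≤ A)
    {P : (Fin n → ℕ) → Prop} (hP : IterEventually l n P) :
    ∃ j, P j ∧ normW (w + ∑ i, y i (j i)) ≤ B + n * ε := by
  obtain ⟨m, hm⟩ := exists_support_le w
  obtain ⟨j, hj, Z, hZ, hZ'⟩ := (hP.and (iterEventually_exists_isTail ((normW_nonneg w).trans hw) hε hd
    h1 h2 h3 hB (max m (S m)))).exists
  refine ⟨j, hj, ?_⟩
  have h4 := normW_add_le_of_controlled hm hZ.support_lt (le_max_left _ _) (le_max_right _ _) hw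
    hZ.norm_le hZ.controlled hB
  have h5 := normW_add_le (w + Z) (∑ i, y i (j i) - Z)
  rw [add_add_sub_cancel] at h5
  linarith

/-- Projections give the bounds by the single norms. Starting beyond ∑ N_i makes the joined list
admissible, and the Schreier factor ½ accounts for the 2 in the last bound. -/
theorem exists_lower_bound {l : Filter ℕ} [l.NeBot] {ε : ℝ} {n : ℕ} {y : Fin n → ℕ → ℕ+ →₀ ℝ}
    {e a : Fin n → ℝ} {N : Fin n → ℕ}
    (h1 : ∀ i, ∀ m : ℕ, ∀ᶠ j in l, normW ((y i j).filter fun k : ℕ+ => (k : ℕ) ≤ m) ≤ ε)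
    (h2 : ∀ i, ∀ᶠ j in l, a i ≤ normW (y i j))
    (h3 : ∀ i, ∀ s : ℕ, ∀ᶠ j in l, ∃ Γ, VFG W Γ ∧ Adm Γ ∧ Γ.length ≤ N i ∧ (∀ p ∈ Γ, s ≤ p.2) ∧
      e i < |ev (y i j) (tot Γ)|) (w : ℕ+ →₀ ℝ) {P : (Fin n → ℕ) → Prop}
    (hP : IterEventually l n P) :
    ∃ j, P j ∧ normW w ≤ normW (w + ∑ i, y i (j i)) + n * ε ∧
      (∀ i, a i - ε ≤ normW (w + ∑ i, y i (j i)) + n * ε) ∧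
      ∑ i, (e i - 2 * ε) ≤ 2 * (normW (w + ∑ i, y i (j i)) + n * ε) := by
  obtain ⟨m, hm⟩ := exists_support_le w
  obtain ⟨j, hj, Z, hZ, hZy, hZa, Γ, g1, g2, g3, g4⟩ := (hP.and (iterEventually_exists_vfg h1 h2 h3
    (max m (∑ i, N i)))).exists
  have hm' : ∀ i ∈ w.support, (i : ℕ) ≤ max m (∑ i, N i) := fun i hi =>
    (hm i hi).trans (le_max_left _ _)
  have h4 : normW (w + Z) ≤ normW (w + ∑ i, y i (j i)) + n * ε := by
    have h5 := normW_sub_le (w + ∑ i, y i (j i)) (∑ i, y i (j i) - Z)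
    rw [add_sub_assoc, sub_sub_cancel] at h5
    linarith
  refine ⟨j, hj, (normW_left_le hm' hZ).trans h4,
    fun i => (hZa i).trans ((normW_right_le hm' hZ).trans h4), ?_⟩
  have h5 : ev w (tot Γ) = 0 := ev_tot_eq_zero fun p hp i hi => by
    by_contra hne
    have := hm' i (by simpa using hne)
    have := (g3 p hp).2 i hi
    omega
  have h6 := abs_ev_tot_le g1 (fun p hp i hi => by
    have := (g3 p hp).2 i hi
    omega) (w + Z)
  rw [ev_add, h5, zero_add] at h6
  have := le_abs_self (ev Z (tot Γ))
  linarith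

theorem isAsymptoticallySymmetricWith_XHalf : IsAsymptoticallySymmetricWith 4 XHalf := by
  refine ⟨by norm_num, fun n x σ L₁ L₂ hb hL₁ hL₂ => ?_⟩
  set 𝒰 : Ultrafilter ℕ := Filter.hyperfilter ℕ
  have h𝒰 : (𝒰 : Filter ℕ) ≤ atTop := Nat.hyperfilter_le_atTop
  -- Any error coefficient depending only on `n` would do; this one leaves ample room.
  have key : ∀ ε : ℝ, 0 < ε → L₁ ≤ 4 * L₂ + (30 * n + 30) * ε := by
    intro ε hε
    choose u hu using fun i j => exists_norm_sub_toX_lt (x i j) hε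
    have hK : ∀ i, ∃ K, ∀ j, normW (u i j) ≤ K := by
      intro i
      obtain ⟨K, hK⟩ := (hb i).exists_norm_le
      refine ⟨K + ε, fun j => ?_⟩
      have h1 := hK _ ⟨j, rfl⟩
      have h2 := norm_sub_le (x i j) (x i j - toX (u i j))
      rw [sub_sub_cancel, norm_toX] at h2
      linarith [hu i j]
    choose K hK using hK
    choose a ha using fun i => exists_eventually_normW_filter_le 𝒰 (hK i) hε
    set y : Fin n → ℕ → ℕ+ →₀ ℝ := fun i j => u i j - a i with hy
    have hyK : ∀ i j, normW (y i j) ≤ K i + normW (a i) := fun i j =>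
      (normW_sub_le _ _).trans (by linarith [hK i j])
    choose θ hθ using fun i => exists_tendsto_of_bounded 𝒰 (r := fun j => normW (y i j)) fun j =>
      (abs_of_nonneg (normW_nonneg _)).trans_le (hyK i j)
    choose δ hδ0 hδ1 hδ2 using fun i => exists_index 𝒰 (hyK i) hε
    choose N hN using hδ1
    choose s hs using hδ2
    -- The fixed part is the sum over all sequences, hence the same for every order.
    set w := ∑ i, a i with hw
    have hdist : ∀ (τ : Equiv.Perm (Fin n)) (j : Fin n → ℕ),
        |‖∑ i, x (τ i) (j i)‖ - normW (w + ∑ i, y (τ i) (j i))| ≤ n * ε := by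
      intro τ j
      have he : w + ∑ i, y (τ i) (j i) = ∑ i, u (τ i) (j i) := by
        rw [hw, ← Equiv.sum_comp τ, ← Finset.sum_add_distrib]
        exact Finset.sum_congr rfl fun i _ => by simp [hy]
      rw [he, ← norm_toX]
      refine (abs_norm_sub_norm_le _ _).trans ?_
      rw [map_sum, ← Finset.sum_sub_distrib]
      refine (norm_sum_le _ _).trans ((Finset.sum_le_sum fun i _ => (hu (τ i) (j i)).le).trans ?_)
      simp
    obtain ⟨j, hj, hw2, hθ2, hδ2⟩ := exists_lower_bound (l := 𝒰) (ε := ε)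
      (y := fun i => y (σ i)) (e := fun i => δ (σ i) - ε) (a := fun i => θ (σ i) - ε)
      (N := fun i => N (σ i)) (fun i => ha _)
      (fun i => (hθ (σ i)).eventually_const_le (by linarith)) (fun i => hN _) w
      (hL₂.iterEventually h𝒰 hε)
    rw [Equiv.sum_comp σ fun i => δ i - ε - 2 * ε] at hδ2
    set F₂ := normW (w + ∑ i, y (σ i) (j i)) with hF₂
    have hF₂L : F₂ ≤ L₂ + (n + 1) * ε := by
      have h1 := (abs_le.mp (hdist σ j)).1
      have h2 := (abs_lt.mp hj).2
      linarith
    have hθ3 : ∀ i, θ i ≤ L₂ + (2 * n + 3) * ε := fun i => by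
      have := hθ2 (σ.symm i)
      rw [Equiv.apply_symm_apply] at this
      linarith
    -- Only finitely many `N ≤ T` matter, so their conditions hold simultaneously; the supremum over
    -- `i` gives one size threshold for all the sequences.
    have hctl : ∀ i T, ∀ᶠ j in (𝒰 : Filter ℕ),
        Controlled (fun N => Finset.univ.sup fun i => s i N) T (y i j) (δ i + ε) := by
      intro i T
      have : ∀ᶠ j in (𝒰 : Filter ℕ), ∀ N ∈ Finset.range (T + 1), ∀ Γ, VFG W Γ → Adm Γ →
          Γ.length ≤ N → (∀ p ∈ Γ, s i N ≤ p.2) → |ev (y i j) (tot Γ)| ≤ δ i + ε :=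
        (Filter.eventually_all_finset _).mpr fun N _ => hs i N
      filter_upwards [this] with j hj N hN Γ h1 h2 h3 h4
      exact hj N (Finset.mem_range.mpr (by omega)) Γ h1 h2 h3 fun p hp =>
        (Finset.le_sup (f := fun i => s i N) (Finset.mem_univ i)).trans (h4 p hp)
    -- Up to multiples of ε, both ‖w‖ and every θ_i are at most L₂ and ∑ δ_i is at most 2 L₂, so the
    -- upper bound 2A + ∑ δ_i becomes 4 L₂.
    obtain ⟨k, hk, hB⟩ := exists_upper_bound (l := 𝒰) (A := L₂ + (2 * n + 4) * ε) hε.le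
      (d := fun i => δ i + ε) hδ0 ha
      (fun i => (hθ i).eventually_le_const (by linarith [hθ3 i])) hctl le_rfl (w := w)
      (by linarith) (hL₁.iterEventually h𝒰 hε)
    have h1 := (abs_le.mp (hdist 1 k)).2
    have h2 := (abs_lt.mp hk).1
    simp only [Equiv.Perm.coe_one, id_eq] at h1
    set F₁ := normW (w + ∑ i, y i (k i))
    have hnε : 0 ≤ n * ε := by positivity
    simp only [Finset.sum_add_distrib, Finset.sum_sub_distrib, Finset.sum_const, Finset.card_univ,
      Fintype.card_fin, nsmul_eq_mul] at hB hδ2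
    linarith
  refine le_of_forall_pos_le_add fun η hη => ?_
  have h := key (η / (30 * n + 30)) (by positivity)
  rwa [mul_div_cancel₀ _ (by positivity)] at h

/-! ### The game -/

/-- The sequence `y` of norm one vectors is a possible outcome of the strategy `S`. -/
def Legal {X : Type*} [NormedAddCommGroup X] [NormedSpace ℝ X] (S : List X → Submodule ℝ X) {n : ℕ}
    (y : Fin n → X) : Prop :=
  ∀ k : Fin n, ‖y k‖ = 1 ∧ y k ∈ S (List.ofFn fun i : Fin k => y (Fin.castLE k.isLt.le i))

theorem Legal.cons {X : Type*} [NormedAddCommGroup X] [NormedSpace ℝ X]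
    {S : List X → Submodule ℝ X} {n : ℕ} {y₀ : X} {y : Fin n → X} (h0 : ‖y₀‖ = 1) (h0' : y₀ ∈ S [])
    (hy : Legal (fun l => S (y₀ :: l)) y) : Legal S (Fin.cons y₀ y : Fin (n + 1) → X) := by
  intro k
  refine Fin.cases ?_ (fun k => ?_) k
  · exact ⟨h0, h0'⟩
  · refine ⟨(hy k).1, ?_⟩
    have h := (hy k).2
    have he : (List.ofFn fun i : Fin ((k : ℕ) + 1) =>
        (Fin.cons y₀ y : Fin (n + 1) → X) (Fin.castLE (Nat.succ_lt_succ k.isLt).le i)) =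
        y₀ :: List.ofFn fun i : Fin k => y (Fin.castLE k.isLt.le i) := by
      rw [List.ofFn_succ]
      rfl
    exact he ▸ h

/-- To produce an outcome with a property `R` that depends on a threshold, it suffices to choose the
vectors one by one, in arbitrary subspaces of finite codimension. -/
theorem exists_legal {X : Type*} [NormedAddCommGroup X] [NormedSpace ℝ X]
    {R : (n : ℕ) → ℕ → (Fin n → X) → Prop} (h0 : ∀ T y, R 0 T y)
    (hs : ∀ n T (Z : Submodule ℝ X), FiniteDimensional ℝ (X ⧸ Z) → ∃ y₀ ∈ Z, ‖y₀‖ = 1 ∧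
      ∃ T₁, ∀ y : Fin n → X, R n T₁ y → R (n + 1) T (Fin.cons y₀ y)) (n : ℕ)
    {S : List X → Submodule ℝ X} (hS : ∀ l, FiniteDimensional ℝ (X ⧸ S l)) (T : ℕ) :
    ∃ y : Fin n → X, Legal S y ∧ R n T y := by
  induction n generalizing S T with
  | zero => exact ⟨Fin.elim0, fun k => k.elim0, h0 _ _⟩
  | succ n ih =>
    obtain ⟨y₀, h1, h2, T₁, h3⟩ := hs n T (S []) (hS [])
    obtain ⟨y, h4, h5⟩ := ih (S := fun l => S (y₀ :: l)) (fun l => hS _) T₁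
    exact ⟨_, Legal.cons h2 h1 h4, h3 y h5⟩

theorem finiteDimensional_quotient_inf {X : Type*} [AddCommGroup X] [Module ℝ X]
    {Z Z' : Submodule ℝ X} (h : FiniteDimensional ℝ (X ⧸ Z)) (h' : FiniteDimensional ℝ (X ⧸ Z')) :
    FiniteDimensional ℝ (X ⧸ (Z ⊓ Z')) :=
  Submodule.CoFG.inf h h'

/-! ### Vectors far out in a subspace -/

/-- The coordinate functionals on the completion. -/
noncomputable def coord (i : ℕ+) : XHalf →L[ℝ] ℝ :=
  (Finsupp.lapply (R := ℝ) (M := ℝ) i).extendOfNorm toX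

theorem denseRange_toX : DenseRange toX :=
  UniformSpace.Completion.denseRange_coe (α := C00)

theorem coord_toX (i : ℕ+) (u : ℕ+ →₀ ℝ) : coord i (toX u) = u i :=
  LinearMap.extendOfNorm_eq denseRange_toX ⟨1, fun x => by
    rw [norm_toX, one_mul]; exact abs_apply_le_normW x i⟩ u

/-- The first `T` coordinates vanish on a subspace of finite codimension, which meets `Z`
nontrivially. A finitely supported approximant then has small coordinates up to `T` by continuity,
and these may be removed. -/
theorem exists_mem_of_finiteDimensional_quotient {Y : Submodule ℝ XHalf}
    (hY : ¬ FiniteDimensional ℝ Y) {Z : Submodule ℝ Y} (hZ : FiniteDimensional ℝ (Y ⧸ Z)) (T : ℕ)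
    {ε : ℝ} (hε : 0 < ε) : ∃ y ∈ Z, ‖y‖ = 1 ∧ ∃ v : ℕ+ →₀ ℝ, (∀ i ∈ v.support, T < (i : ℕ)) ∧
      ‖(y : XHalf) - toX v‖ ≤ ε := by
  let φ : Y →ₗ[ℝ] (below T → ℝ) := LinearMap.pi fun i => (coord i).toLinearMap ∘ₗ Y.subtype
  have hfin : FiniteDimensional ℝ (Y ⧸ (Z ⊓ LinearMap.ker φ)) :=
    finiteDimensional_quotient_inf hZ (Submodule.CoFG.ker φ)
  have hne : Z ⊓ LinearMap.ker φ ≠ ⊥ := by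
    intro h
    rw [h] at hfin
    exact hY (LinearEquiv.finiteDimensional (Submodule.quotEquivOfEqBot _ rfl))
  obtain ⟨y, hy, hy0⟩ := Submodule.exists_mem_ne_zero_of_ne_bot hne
  have hn : ‖y‖ ≠ 0 := norm_ne_zero_iff.mpr hy0
  have hy' := Submodule.smul_mem _ ‖y‖⁻¹ hy
  refine ⟨‖y‖⁻¹ • y, hy'.1, by rw [norm_smul, norm_inv, norm_norm, inv_mul_cancel₀ hn], ?_⟩
  generalize ‖y‖⁻¹ • y = z at hy'
  have hz : ∀ i ∈ below T, coord i (z : XHalf) = 0 := fun i hi =>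
    congrFun (LinearMap.mem_ker.mp hy'.2) ⟨i, hi⟩
  set K := ∑ i ∈ below T, ‖coord i‖ with hK
  have hK0 : 0 ≤ K := Finset.sum_nonneg fun _ _ => norm_nonneg _
  obtain ⟨u, hu⟩ := exists_norm_sub_toX_lt (z : XHalf) (ε := ε / (K + 1)) (by positivity)
  refine ⟨u.filter fun i : ℕ+ => T < (i : ℕ), fun i hi => mem_support_filter hi, ?_⟩
  have h1 : normW (u.filter fun i : ℕ+ => (i : ℕ) ≤ T) ≤ K * ‖(z : XHalf) - toX u‖ := by
    refine (normW_le_sum (s := below T) fun i hi => mem_below.mpr (mem_support_filter hi)).trans ?_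
    rw [hK, Finset.sum_mul]
    refine Finset.sum_le_sum fun i hi => ?_
    rw [Finsupp.filter_apply_pos (fun i : ℕ+ => (i : ℕ) ≤ T) u (mem_below.mp hi), ← coord_toX]
    have h2 := (coord i).le_opNorm ((z : XHalf) - toX u)
    rwa [map_sub, hz i hi, zero_sub, norm_neg, Real.norm_eq_abs] at h2
  have h3 : (z : XHalf) - toX (u.filter fun i : ℕ+ => T < (i : ℕ)) =
      ((z : XHalf) - toX u) + toX (u.filter fun i : ℕ+ => (i : ℕ) ≤ T) := by
    conv_rhs => rw [← filter_le_add_filter_lt T u, map_add]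
    simp only [filter_le_add_filter_lt]
    abel
  rw [h3]
  refine (norm_add_le _ _).trans ?_
  rw [norm_toX]
  calc _ ≤ (K + 1) * ‖(z : XHalf) - toX u‖ := by linarith
    _ ≤ (K + 1) * (ε / (K + 1)) := by gcongr
    _ = ε := mul_div_cancel₀ _ (by positivity)

/-- Two games are nested: the blocks answer the strategy `S` of an inner game while staying in `Z`,
the subspace offered in one round of an outer game. Linear combinations of the blocks are thus
available as moves of the outer game. -/
theorem exists_legal_blocks {Y : Submodule ℝ XHalf} (hY : ¬ FiniteDimensional ℝ Y)
    {Z : Submodule ℝ Y} (hZ : FiniteDimensional ℝ (Y ⧸ Z)) {S : List Y → Submodule ℝ Y}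
    (hS : ∀ l, FiniteDimensional ℝ (Y ⧸ S l)) (R T : ℕ) {ε : ℝ} (hε : 0 < ε) :
    ∃ w : Fin R → Y, Legal S w ∧ (∀ k, w k ∈ Z) ∧ ∃ v : Fin R → ℕ+ →₀ ℝ,
      (∀ k, ‖(w k : XHalf) - toX (v k)‖ ≤ ε) ∧ (∀ k, ∀ i ∈ (v k).support, T < (i : ℕ)) ∧
      ∀ i j, i < j → Before (v i) (v j) := by
  refine exists_legal (R := fun R T w => (∀ k, w k ∈ Z) ∧ ∃ v : Fin R → ℕ+ →₀ ℝ,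
      (∀ k, ‖(w k : XHalf) - toX (v k)‖ ≤ ε) ∧ (∀ k, ∀ i ∈ (v k).support, T < (i : ℕ)) ∧
      ∀ i j, i < j → Before (v i) (v j)) ?_ ?_ R hS T
  · exact fun T w => ⟨fun k => k.elim0, Fin.elim0, fun k => k.elim0, fun k => k.elim0,
      fun k => k.elim0⟩
  · intro n T Z' hZ'
    obtain ⟨y, hy, hy1, u, hu, huy⟩ := exists_mem_of_finiteDimensional_quotient hY
      (finiteDimensional_quotient_inf hZ' hZ) T hε
    obtain ⟨m, hm⟩ := exists_support_le u
    refine ⟨y, hy.1, hy1, max m T, ?_⟩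
    rintro w ⟨hw, v, h1, h2, h3⟩
    refine ⟨Fin.cases hy.2 hw, Fin.cons u v, Fin.cases huy h1, Fin.cases hu fun k i hi =>
      (le_max_right m T).trans_lt (h2 k i hi), ?_⟩
    refine Fin.cases ?_ fun i => ?_
    · refine Fin.cases (fun h => absurd h (lt_irrefl _)) fun j _ => ?_
      exact Before.of_le hm fun i hi => (le_max_left m T).trans_lt (h2 j i hi)
    · refine Fin.cases (fun h => absurd h (Fin.not_lt_zero _)) fun j hij => ?_
      exact h3 i j (Fin.succ_lt_succ_iff.mp hij)

/-! ### Norms of sums in `ℓ_p` sequences -/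

theorem IsEquivalentToLpBasis.norm_sum {X : Type*} [NormedAddCommGroup X] [NormedSpace ℝ X] {C : ℝ}
    {p : ℝ≥0∞} (hp : 1 ≤ p) (hp' : p ≠ ∞) {n : ℕ} {y : Fin n → X} (h : IsEquivalentToLpBasis C p y)
    (E : Finset (Fin n)) : C⁻¹ * (E.card : ℝ) ^ (1 / p.toReal) ≤ ‖∑ i ∈ E, y i‖ ∧
      ‖∑ i ∈ E, y i‖ ≤ C * (E.card : ℝ) ^ (1 / p.toReal) := by
  classical
  have hp0 : 0 < p.toReal := ENNReal.toReal_pos (by positivity) hp'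
  have h1 := h fun i => if i ∈ E then 1 else 0
  rw [PiLp.norm_eq_sum hp0] at h1
  have h2 : ∑ i, (if i ∈ E then (1 : ℝ) else 0) • y i = ∑ i ∈ E, y i := by
    simp [ite_smul, Finset.sum_ite_mem]
  have h3 : ∑ i, ‖(WithLp.toLp p (fun i => if i ∈ E then (1 : ℝ) else 0) :
      PiLp p fun _ : Fin n => ℝ) i‖ ^ p.toReal = (E.card : ℝ) := by
    have : ∀ i, ‖(WithLp.toLp p (fun i => if i ∈ E then (1 : ℝ) else 0) :
      PiLp p fun _ : Fin n => ℝ) i‖ ^ p.toReal = if i ∈ E then 1 else 0 := by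
      intro i
      by_cases hi : i ∈ E
      · simp [hi]
      · simp [hi, Real.zero_rpow hp0.ne']
    rw [Finset.sum_congr rfl fun i _ => this i]
    simp
  rwa [h2, h3] at h1

theorem IsEquivalentToLpBasis.norm_sum_top {X : Type*} [NormedAddCommGroup X] [NormedSpace ℝ X]
    {C : ℝ} {n : ℕ} (hn : 0 < n) {y : Fin n → X} (h : IsEquivalentToLpBasis C ∞ y) :
    C⁻¹ ≤ ‖∑ i, y i‖ ∧ ‖∑ i, y i‖ ≤ C := by
  have h1 := h fun _ => 1
  have : Nonempty (Fin n) := ⟨⟨0, hn⟩⟩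
  rw [PiLp.norm_eq_ciSup] at h1
  simpa using h1

/-! ### Averages of `ℓ_p` sequences have small index -/

/-- A substitute for concavity: the bound is affine in `t`, so summing powers of cardinalities only
requires the sum of the cardinalities. -/
theorem rpow_le_mul_one_add_div {t b r : ℝ} (ht : 0 ≤ t) (hb : 0 < b) (hr : 0 ≤ r) (hr1 : r ≤ 1) :
    t ^ r ≤ b ^ r * (1 + t / b) := by
  have hbr : 0 ≤ b ^ r := Real.rpow_nonneg hb.le _
  rcases le_total t b with h | h
  · calc t ^ r ≤ b ^ r := Real.rpow_le_rpow ht h hr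
      _ ≤ _ := le_mul_of_one_le_right hbr (le_add_of_nonneg_right (by positivity))
  · have h1 : 1 ≤ t / b := (one_le_div hb).mpr h
    calc t ^ r = b ^ r * (t / b) ^ r := by
          rw [← Real.mul_rpow hb.le (by positivity), mul_div_cancel₀ _ hb.ne']
      _ ≤ b ^ r * (t / b) ^ (1 : ℝ) := by gcongr
      _ ≤ _ := by rw [Real.rpow_one]; gcongr; linarith

/-- The pairs (l, m) with overlapping supports form a monotone staircase, on which l + m is
injective. -/
theorem sum_card_touching_le {d R : ℕ} {f : Fin d → ℕ+ →₀ ℝ} {w : Fin R → ℕ+ →₀ ℝ}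
    (hf : ∀ i j, i < j → Before (f i) (f j)) (hw : ∀ i j, i < j → Before (w i) (w j)) :
    ∑ l, (Finset.univ.filter fun m => ¬ Disjoint (f l).support (w m).support).card ≤ d + R := by
  classical
  rw [← Finset.card_sigma, ← Finset.card_range (d + R)]
  have hmono : ∀ l l' m m', ¬ Disjoint (f l).support (w m).support →
      ¬ Disjoint (f l').support (w m').support → l < l' → m ≤ m' := by
    intro l l' m m' h h' hl
    by_contra! hm
    obtain ⟨i, hi, hi'⟩ := Finset.not_disjoint_iff.mp h
    obtain ⟨k, hk, hk'⟩ := Finset.not_disjoint_iff.mp h'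
    exact lt_asymm (hf l l' hl i hi k hk) (hw m' m hm k hk' i hi')
  refine Finset.card_le_card_of_injOn (fun x => (x.1 : ℕ) + x.2) ?_ ?_
  · rintro ⟨l, m⟩ -
    simp only [Finset.coe_range, Set.mem_Iio]
    omega
  · rintro ⟨l, m⟩ h ⟨l', m'⟩ h' he
    simp only [Finset.coe_sigma, Set.mem_sigma_iff, Finset.mem_coe, Finset.mem_univ, true_and,
      Finset.mem_filter] at h h'
    simp only at he
    rcases lt_trichotomy l l' with hl | rfl | hl
    · have := hmono l l' m m' h h' hl
      rw [Fin.lt_def] at hl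
      rw [Fin.le_def] at this
      omega
    · obtain rfl : m = m' := Fin.ext (by omega)
      rfl
    · have := hmono l' l m' m h' h hl
      rw [Fin.lt_def] at hl
      rw [Fin.le_def] at this
      omega

/-- Each summand of the average sees only the blocks it touches, and the staircase count leaves at
most s + R incidences. Concavity of the power r makes the worst case an even distribution, about R/s
+ 1 blocks per summand. -/
theorem abs_ev_average_le {R : ℕ} {w : Fin R → ℕ+ →₀ ℝ} (hw : ∀ i j, i < j → Before (w i) (w j))
    {C r : ℝ} (hC : 0 ≤ C) (hr : 0 ≤ r) (hr1 : r ≤ 1)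
    (h : ∀ E : Finset (Fin R), normW (∑ i ∈ E, w i) ≤ C * (E.card : ℝ) ^ r) {s : ℕ} {a : ℕ+ →₀ ℝ}
    (ha : IsAlphaAverage W s a) : |ev (∑ i, w i : ℕ+ →₀ ℝ) a| ≤ 2 * C * (R / s + 1) ^ r := by
  classical
  obtain ⟨d, hd, hds, f, hf, hB, rfl⟩ := ha
  have hs : (0 : ℝ) < s := by exact_mod_cast (by omega : 0 < s)
  set E : Fin d → Finset (Fin R) := fun l =>
    Finset.univ.filter fun m => ¬ Disjoint (f l).support (w m).support with hE
  set b : ℝ := R / s + 1 with hb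
  have hb0 : 0 < b := by positivity
  have h1 : ∀ l, |ev (∑ i, w i : ℕ+ →₀ ℝ) (f l)| ≤ C * (b ^ r * (1 + (E l).card / b)) := by
    intro l
    have h2 : ev (∑ i, w i : ℕ+ →₀ ℝ) (f l) = ev (∑ i ∈ E l, w i : ℕ+ →₀ ℝ) (f l) := by
      rw [ev_sum, ev_sum]
      symm
      refine Finset.sum_subset (Finset.subset_univ _) fun m _ hm => ev_eq_zero fun i hi => ?_
      have hm' : Disjoint (f l).support (w m).support := by simpa [hE] using hm
      simpa using Finset.disjoint_left.mp hm' hi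
    rw [h2]
    refine (abs_ev_le (hf l) _).trans ((h _).trans ?_)
    gcongr
    exact rpow_le_mul_one_add_div (by positivity) hb0 hr hr1
  have hcount : (∑ l, (E l).card : ℝ) ≤ s + R := by
    have := sum_card_touching_le hB hw
    exact_mod_cast this.trans (by omega : d + R ≤ s + R)
  have hd' : (d : ℝ) ≤ s := by exact_mod_cast hds
  rw [map_smul, smul_eq_mul, abs_mul, abs_of_pos (by positivity), one_div, inv_mul_le_iff₀ hs, map_sum]
  have hsb : s * b = s + R := by rw [hb]; field_simp; ring
  calc _ ≤ ∑ l, C * (b ^ r * (1 + (E l).card / b)) :=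
        (Finset.abs_sum_le_sum_abs _ _).trans (Finset.sum_le_sum fun l _ => h1 l)
    _ = C * (b ^ r * (d + (∑ l, (E l).card : ℝ) / b)) := by
        rw [← Finset.mul_sum, ← Finset.mul_sum, Finset.sum_add_distrib, Finset.sum_div]
        simp
    _ ≤ C * (b ^ r * (s + (s * b) / b)) := by gcongr; rw [hsb]; exact hcount
    _ = s * (2 * C * b ^ r) := by rw [mul_div_cancel_right₀ _ hb0.ne']; ring

theorem not_finiteDimensional_XHalf : ¬ FiniteDimensional ℝ XHalf := by
  intro h
  have hinj : Function.Injective toX := by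
    rw [injective_iff_map_eq_zero]
    intro u hu
    ext i
    rw [← coord_toX, hu, map_zero, Finsupp.zero_apply]
  have h1 : FiniteDimensional ℝ (ℕ+ →₀ ℝ) := FiniteDimensional.of_injective toX hinj
  have h2 : Finite ℕ+ := Module.Finite.finite_basis (Finsupp.basisSingleOne (R := ℝ) (ι := ℕ+))
  exact not_finite ℕ+

/-! ### Subspaces that are asymptotic-`ℓ_p` with `p < ∞` -/

theorem norm_sum_sub_toX_le {Y : Submodule ℝ XHalf} {n : ℕ} {w : Fin n → Y} {v : Fin n → ℕ+ →₀ ℝ}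
    {ε : ℝ} (hε : 0 ≤ ε) (h : ∀ k, ‖(w k : XHalf) - toX (v k)‖ ≤ ε) (E : Finset (Fin n)) :
    ‖((∑ k ∈ E, w k : Y) : XHalf) - toX (∑ k ∈ E, v k)‖ ≤ n * ε := by
  rw [AddSubmonoidClass.coe_finsetSum, map_sum, ← Finset.sum_sub_distrib]
  refine (norm_sum_le _ _).trans ((Finset.sum_le_sum fun k _ => h k).trans ?_)
  rw [Finset.sum_const, nsmul_eq_mul]
  gcongr
  simpa using Finset.card_le_univ E

/-- The sum of `R` blocks has norm of order R^{1/p}, and an average of size s on it is of order (R/s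
+ 1)^{1/p}. The quotient is small when both `R` and s are large. -/
theorem exists_small_index {Y : Submodule ℝ XHalf} (hY : ¬ FiniteDimensional ℝ Y) {p : ℝ≥0∞}
    (hp : 1 ≤ p) (hp' : p ≠ ∞) {C : ℝ} (hC : 1 ≤ C)
    (hS : ∀ n : ℕ, ∃ S : List Y → Submodule ℝ Y, (∀ l, FiniteDimensional ℝ (Y ⧸ S l)) ∧
      ∀ y : Fin n → Y, Legal S y → IsEquivalentToLpBasis C p y)
    {Z : Submodule ℝ Y} (hZ : FiniteDimensional ℝ (Y ⧸ Z)) (T : ℕ) {R : ℕ} (hR : 0 < R) {ε : ℝ}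
    (hε : 0 < ε) (hε1 : ε ≤ 1) :
    ∃ y ∈ Z, ‖y‖ = 1 ∧ ∃ u : ℕ+ →₀ ℝ, (∀ i ∈ u.support, T < (i : ℕ)) ∧
      ‖(y : XHalf) - toX u‖ ≤ ε ∧ ∀ s a, IsAlphaAverage W s a →
        |ev u a| ≤ 4 * C ^ 2 * (1 / s + 1 / R) ^ (1 / p.toReal) := by
  obtain ⟨S, hSf, hSp⟩ := hS R
  have hC0 : 0 < C := by linarith
  have hR0 : (0 : ℝ) < R := by exact_mod_cast hR
  have hR1 : (1 : ℝ) ≤ R := by exact_mod_cast hR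
  set r := 1 / p.toReal with hr
  have hp1 : 1 ≤ p.toReal := by
    rw [← ENNReal.toReal_one]
    exact ENNReal.toReal_mono hp' hp
  have hr0 : 0 ≤ r := by positivity
  have hr1 : r ≤ 1 := by rw [hr, div_le_one (by linarith)]; exact hp1
  obtain ⟨w, hw, hwZ, v, hv, hvT, hvB⟩ := exists_legal_blocks hY hZ hSf R T (ε := ε / (C * R))
    (by positivity)
  have hnorm := (hSp w hw).norm_sum hp hp'
  have hδ : (R : ℝ) * (ε / (C * R)) = ε / C := by field_simp
  have hdist : ∀ E, ‖((∑ k ∈ E, w k : Y) : XHalf) - toX (∑ k ∈ E, v k)‖ ≤ ε / C := fun E =>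
    (norm_sum_sub_toX_le (by positivity) hv E).trans hδ.le
  have hεC : ε / C ≤ C := by rw [div_le_iff₀ hC0]; nlinarith
  have hE : ∀ E : Finset (Fin R), normW (∑ i ∈ E, v i) ≤ 2 * C * (E.card : ℝ) ^ r := by
    intro E
    rcases E.eq_empty_or_nonempty with rfl | hne
    · rw [Finset.sum_empty, normW_zero]; positivity
    · have h1 : (1 : ℝ) ≤ (E.card : ℝ) ^ r :=
        Real.one_le_rpow (by exact_mod_cast hne.card_pos) hr0
      have h2 := norm_sub_le ((∑ k ∈ E, w k : Y) : XHalf) (((∑ k ∈ E, w k : Y) : XHalf) - toX (∑ k ∈ E, v k))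
      rw [sub_sub_cancel, norm_toX] at h2
      have h3 : ‖((∑ k ∈ E, w k : Y) : XHalf)‖ ≤ C * (E.card : ℝ) ^ r := (hnorm E).2
      have h4 := hdist E
      nlinarith
  set x := ∑ k, w k with hx
  have hxn : C⁻¹ * (R : ℝ) ^ r ≤ ‖x‖ := by
    have h1 := (hnorm Finset.univ).1
    rwa [Finset.card_univ, Fintype.card_fin] at h1
  have hRr : (1 : ℝ) ≤ (R : ℝ) ^ r := Real.one_le_rpow hR1 hr0
  have hx0 : 0 < ‖x‖ := lt_of_lt_of_le (by positivity) hxn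
  have hinv : ‖x‖⁻¹ ≤ C / (R : ℝ) ^ r := by
    rw [inv_le_comm₀ hx0 (by positivity), inv_div, div_eq_inv_mul]
    exact hxn
  refine ⟨‖x‖⁻¹ • x, Z.smul_mem _ (Z.sum_mem fun k _ => hwZ k), ?_, ‖x‖⁻¹ • ∑ k, v k, ?_, ?_, ?_⟩
  · rw [norm_smul, norm_inv, norm_norm, inv_mul_cancel₀ hx0.ne']
  · intro i hi
    obtain ⟨k, -, hk⟩ := Finset.mem_biUnion.mp (Finsupp.support_finsetSum (Finsupp.support_smul hi))
    exact hvT k i hk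
  · rw [map_smul, Submodule.coe_smul, ← smul_sub, norm_smul, norm_inv, norm_norm]
    calc ‖x‖⁻¹ * _ ≤ C * (ε / C) := by
          gcongr
          · exact hinv.trans (div_le_self hC0.le hRr)
          · exact hdist Finset.univ
      _ = ε := mul_div_cancel₀ _ hC0.ne'
  · intro s a ha
    have h1 := abs_ev_average_le hvB (by positivity) hr0 hr1 hE ha
    rw [ev_smul, abs_mul, abs_of_pos (by positivity)]
    have hs : (0 : ℝ) < s := by
      obtain ⟨d, h1, h2, -⟩ := ha
      exact_mod_cast (by omega : 0 < s)
    have h2 : (R : ℝ) / s + 1 = R * (1 / s + 1 / R) := by field_simp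
    rw [h2, Real.mul_rpow hR0.le (by positivity)] at h1
    calc ‖x‖⁻¹ * _ ≤ C / (R : ℝ) ^ r * (2 * (2 * C) * ((R : ℝ) ^ r * (1 / s + 1 / R) ^ r)) := by
          gcongr
      _ = _ := by field_simp; ring

theorem abs_ev_tot_le_of_forall {u : ℕ+ →₀ ℝ} {b : ℝ} {Γ : List ((ℕ+ →₀ ℝ) × ℕ)}
    (h : ∀ p ∈ Γ, |ev u p.1| ≤ b) : |ev u (tot Γ)| ≤ Γ.length * b := by
  induction Γ with
  | nil => simp
  | cons p Γ ih =>
    rw [tot_cons, map_add]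
    have h1 := h p (by simp)
    have h2 := ih fun q hq => h q (List.mem_cons_of_mem _ hq)
    calc _ ≤ b + Γ.length * b := (abs_add_le _ _).trans (add_le_add h1 h2)
      _ = _ := by push_cast [List.length_cons]; ring

theorem exists_threshold {K r η : ℝ} (hr : 0 < r) (hη : 0 < η) (N : ℕ) :
    ∃ S : ℕ, 0 < S ∧ N * (K * (2 / (S : ℝ)) ^ r) ≤ η := by
  have h : Tendsto (fun S : ℕ => N * (K * (2 / (S : ℝ)) ^ r)) atTop (𝓝 (N * (K * 0 ^ r))) :=
    (((tendsto_const_div_atTop_nhds_zero_nat 2).rpow_const (Or.inr hr.le)).const_mul K).const_mul _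
  rw [Real.zero_rpow hr.ne', mul_zero, mul_zero] at h
  obtain ⟨S, h1, h2⟩ := ((h.eventually_le_const hη).and (eventually_gt_atTop 0)).exists
  exact ⟨S, h2, h1⟩

theorem not_isAsymptoticLp_of_ne_top {Y : Submodule ℝ XHalf} (hY : ¬ FiniteDimensional ℝ Y)
    {p : ℝ≥0∞} (hp : 1 ≤ p) (hp' : p ≠ ∞) : ¬ IsAsymptoticLp p Y := by
  rintro ⟨C, hC, hgame⟩
  have hS : ∀ n : ℕ, ∃ S : List Y → Submodule ℝ Y, (∀ l, FiniteDimensional ℝ (Y ⧸ S l)) ∧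
      ∀ y : Fin n → Y, Legal S y → IsEquivalentToLpBasis C p y := fun n => by
    obtain ⟨S, h1, h2⟩ := hgame n
    exact ⟨S, fun l => (h1 l).2, h2⟩
  set r := 1 / p.toReal with hr
  have hr0 : 0 < r := one_div_pos.mpr (ENNReal.toReal_pos (by positivity) hp')
  -- 6 = 5 + 1: the tail bound is B = 5 = 2 · 2 + 1, from vectors of norm at most 2 and total
  -- control nη ≤ 1, and the approximation costs at most another 1.
  obtain ⟨n, hn⟩ : ∃ n : ℕ, 6 * C < (n : ℝ) ^ r :=
    (((tendsto_rpow_atTop hr0).comp tendsto_natCast_atTop_atTop).eventually_gt_atTop _).exists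
  set η : ℝ := 1 / (n + 1) with hη
  have hη0 : 0 < η := by positivity
  have hη1 : η ≤ 1 := by
    rw [hη, div_le_one (by positivity)]
    have : (0 : ℝ) ≤ n := by positivity
    linarith
  have hnη : n * η ≤ 1 := by
    rw [hη, mul_one_div, div_le_one (by positivity)]
    linarith
  choose S₀ hS₀ hS₀' using fun N => exists_threshold (K := 4 * C ^ 2) hr0 hη0 N
  obtain ⟨S, hSf, hSp⟩ := hS n
  obtain ⟨y, hy, hyR⟩ := exists_legal (X := Y) (n := n) (S := S)
    (R := fun k T y => k ≤ n → ∃ Z, IsTail S₀ T Z 5 (k * η) ∧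
      ‖((∑ i, y i : Y) : XHalf) - toX Z‖ ≤ k * η) (by
      intro T y _
      refine ⟨0, by simpa using isTail_zero S₀ T (by norm_num), by simp⟩) (by
      intro k T Z hZ
      -- `R` must dominate the thresholds of all `N ≤ T`, the list lengths for which control is
      -- claimed; then 1/s + 1/R ≤ 2/S₀ N.
      set R := (Finset.range (T + 1)).sup S₀ with hR
      have hSR : ∀ N ≤ T, S₀ N ≤ R := fun N hN =>
        Finset.le_sup (f := S₀) (Finset.mem_range.mpr (by omega))
      have hR0 : 0 < R := (hS₀ 0).trans_le (hSR 0 (Nat.zero_le _))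
      obtain ⟨y₀, h1, h2, u, h3, h4, h5⟩ := exists_small_index hY hp hp' hC hS hZ T hR0 hη0 hη1
      obtain ⟨m, hm⟩ := exists_support_le u
      refine ⟨y₀, h1, h2, max T (max m (S₀ m)), fun y hy hk => ?_⟩
      obtain ⟨Z', hZ', hyZ⟩ := hy (by omega)
      have hctl : Controlled S₀ T u η := by
        intro N hN Γ g1 g2 g3 g4
        refine (abs_ev_tot_le_of_forall (b := 4 * C ^ 2 * (2 / (S₀ N : ℝ)) ^ r) fun q hq => ?_).trans
          (le_trans (by gcongr) (hS₀' N))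
        refine (h5 q.2 q.1 (g1.1 q hq)).trans ?_
        have h6 : (0 : ℝ) < S₀ N := by exact_mod_cast hS₀ N
        have h7 : (S₀ N : ℝ) ≤ q.2 := by exact_mod_cast g4 q hq
        have h8 : (S₀ N : ℝ) ≤ R := by exact_mod_cast hSR N hN
        have h9 : 1 / (q.2 : ℝ) + 1 / R ≤ 2 / S₀ N := by
          have := one_div_le_one_div_of_le h6 h7
          have := one_div_le_one_div_of_le h6 h8
          have : (2 : ℝ) / S₀ N = 1 / S₀ N + 1 / S₀ N := by ring
          linarith
        gcongr
      have hu : normW u ≤ 2 := by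
        have h6 := norm_sub_le (y₀ : XHalf) ((y₀ : XHalf) - toX u)
        rw [sub_sub_cancel, norm_toX] at h6
        have h7 : ‖(y₀ : XHalf)‖ = 1 := h2
        linarith
      have hkη : k * η ≤ 1 := by
        refine le_trans ?_ hnη
        gcongr
        omega
      refine ⟨u + Z', ?_, ?_⟩
      · have := hZ'.add h3 hm (le_max_left _ _) ((le_max_left _ _).trans (le_max_right _ _))
          ((le_max_right _ _).trans (le_max_right _ _)) hu hctl (by linarith)
        have he : ((k + 1 : ℕ) : ℝ) * η = η + k * η := by push_cast; ring
        rwa [he]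
      · rw [Fin.sum_univ_succ]
        simp only [Fin.cons_zero, Fin.cons_succ]
        rw [map_add, Submodule.coe_add, add_sub_add_comm]
        refine (norm_add_le _ _).trans ?_
        push_cast at hyZ ⊢
        linarith) hSf 0
  obtain ⟨Z, hZ, hyZ⟩ := hyR le_rfl
  have h1 := ((hSp y hy).norm_sum hp hp' Finset.univ).1
  rw [Finset.card_univ, Fintype.card_fin, inv_mul_le_iff₀ (by linarith)] at h1
  have h2 : ‖∑ i, y i‖ ≤ 6 := by
    have h3 := norm_add_le (((∑ i, y i : Y) : XHalf) - toX Z) (toX Z)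
    rw [sub_add_cancel, norm_toX] at h3
    have h4 : ‖((∑ i, y i : Y) : XHalf)‖ = ‖∑ i, y i‖ := rfl
    have := hZ.norm_le
    linarith
  have h3 : C * ‖∑ i, y i‖ ≤ C * 6 := by gcongr
  linarith

/-! ### Subspaces that are asymptotic-`c₀` -/

/-- In the c₀ case the sum of `R` blocks has norm at most `C`, yet averaging `R` functionals that
almost norm the single blocks gives at least ½ on it. Normalizing leaves 1/(2C), however large `R`
is. -/
theorem exists_large_index {Y : Submodule ℝ XHalf} (hY : ¬ FiniteDimensional ℝ Y) {C : ℝ}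
    (hC : 1 ≤ C)
    (hS : ∀ n : ℕ, ∃ S : List Y → Submodule ℝ Y, (∀ l, FiniteDimensional ℝ (Y ⧸ S l)) ∧
      ∀ y : Fin n → Y, Legal S y → IsEquivalentToLpBasis C ∞ y)
    {Z : Submodule ℝ Y} (hZ : FiniteDimensional ℝ (Y ⧸ Z)) (T : ℕ) {R : ℕ} (hR : 0 < R) {ε : ℝ}
    (hε : 0 < ε) (hε1 : ε ≤ 1 / 4) :
    ∃ y ∈ Z, ‖y‖ = 1 ∧ ∃ u : ℕ+ →₀ ℝ, (∀ i ∈ u.support, T < (i : ℕ)) ∧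
      ‖(y : XHalf) - toX u‖ ≤ ε ∧ ∃ a, IsAlphaAverage W R a ∧ (∀ i ∈ a.support, T < (i : ℕ)) ∧
        1 / (2 * C) ≤ ev u a := by
  obtain ⟨S, hSf, hSp⟩ := hS R
  have hC0 : 0 < C := by linarith
  have hR0 : (0 : ℝ) < R := by exact_mod_cast hR
  have hR1 : (1 : ℝ) ≤ R := by exact_mod_cast hR
  obtain ⟨w, hw, hwZ, v, hv, hvT, hvB⟩ := exists_legal_blocks hY hZ hSf R T (ε := ε / (C * R))
    (by positivity)
  obtain ⟨hlow, hup⟩ := (hSp w hw).norm_sum_top hR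
  have hδ : (R : ℝ) * (ε / (C * R)) = ε / C := by field_simp
  have hdist := (norm_sum_sub_toX_le (by positivity) hv Finset.univ).trans hδ.le
  have hvn : ∀ k, 1 / 2 < normW (v k) := by
    intro k
    have h1 := norm_sub_norm_le (w k : XHalf) (toX (v k))
    have h2 : ‖(w k : XHalf)‖ = 1 := (hw k).1
    have h3 : ε / (C * R) ≤ ε := div_le_self hε.le (one_le_mul_of_one_le_of_one_le hC hR1)
    rw [norm_toX, h2] at h1
    linarith [hv k]
  choose f hf hfv hfs using fun k => exists_mem_W_lt' (by norm_num) (hvn k)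
  have hfB : ∀ i j, i < j → Before (f i) (f j) := fun i j hij => (hvB i j hij).mono (hfs i) (hfs j)
  have hcross : ∀ i j, i ≠ j → ev (v i) (f j) = 0 := by
    intro i j hij
    refine ev_eq_zero fun k hk => ?_
    by_contra hne
    have h1 : k ∈ (v i).support := by simpa using hne
    have h2 := hfs j hk
    rcases lt_or_gt_of_ne hij with h | h
    · exact lt_irrefl _ (hvB i j h k h1 k h2)
    · exact lt_irrefl _ (hvB j i h k h2 k h1)
  set x := ∑ k, w k with hx
  have hx0 : 0 < ‖x‖ := lt_of_lt_of_le (by positivity) hlow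
  have hinv : ‖x‖⁻¹ ≤ C := by rwa [inv_le_comm₀ hx0 hC0]
  have hinv' : C⁻¹ ≤ ‖x‖⁻¹ := inv_anti₀ hx0 hup
  refine ⟨‖x‖⁻¹ • x, Z.smul_mem _ (Z.sum_mem fun k _ => hwZ k), ?_, ‖x‖⁻¹ • ∑ k, v k, ?_, ?_,
    (1 / (R : ℝ)) • ∑ k, f k, ⟨R, hR, le_rfl, f, hf, hfB, rfl⟩, ?_, ?_⟩
  · rw [norm_smul, norm_inv, norm_norm, inv_mul_cancel₀ hx0.ne']
  · intro i hi
    obtain ⟨k, -, hk⟩ := Finset.mem_biUnion.mp (Finsupp.support_finsetSum (Finsupp.support_smul hi))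
    exact hvT k i hk
  · rw [map_smul, Submodule.coe_smul, ← smul_sub, norm_smul, norm_inv, norm_norm]
    calc ‖x‖⁻¹ * _ ≤ C * (ε / C) := by gcongr
      _ = ε := mul_div_cancel₀ _ hC0.ne'
  · intro i hi
    obtain ⟨k, -, hk⟩ := Finset.mem_biUnion.mp (Finsupp.support_finsetSum (Finsupp.support_smul hi))
    exact hvT k i (hfs k hk)
  · have h1 : (1 / 2 : ℝ) ≤ ev (∑ k, v k : ℕ+ →₀ ℝ) ((1 / (R : ℝ)) • ∑ k, f k) := by
      rw [map_smul, smul_eq_mul, one_div (R : ℝ), le_inv_mul_iff₀ hR0, map_sum]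
      calc (R : ℝ) * (1 / 2) = ∑ _k : Fin R, (1 / 2 : ℝ) := by simp
        _ ≤ ∑ k, ev (v k) (f k) := Finset.sum_le_sum fun k _ => (hfv k).le
        _ = _ := by
          refine Finset.sum_congr rfl fun k _ => ?_
          rw [ev_sum, Finset.sum_eq_single k (fun i _ hi => hcross i k hi) (by simp)]
    rw [ev_smul]
    calc 1 / (2 * C) = C⁻¹ * (1 / 2) := by field_simp
      _ ≤ _ := by gcongr

theorem not_isAsymptoticLp_top {Y : Submodule ℝ XHalf} (hY : ¬ FiniteDimensional ℝ Y) :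
    ¬ IsAsymptoticLp ∞ Y := by
  rintro ⟨C, hC, hgame⟩
  have hC0 : 0 < C := by linarith
  have hS : ∀ n : ℕ, ∃ S : List Y → Submodule ℝ Y, (∀ l, FiniteDimensional ℝ (Y ⧸ S l)) ∧
      ∀ y : Fin n → Y, Legal S y → IsEquivalentToLpBasis C ∞ y := fun n => by
    obtain ⟨S, h1, h2⟩ := hgame n
    exact ⟨S, fun l => (h1 l).2, h2⟩
  -- The Schreier estimate will read n/(2C) ≤ 2(C + n/(8C)), that is n ≤ 8C².
  obtain ⟨n, hn⟩ := exists_nat_gt (8 * C ^ 2)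
  have hn0 : 0 < n := by
    have : (0 : ℝ) < n := lt_trans (by positivity) hn
    exact_mod_cast this
  set ε : ℝ := 1 / (8 * C) with hε
  have hε0 : 0 < ε := by positivity
  have hε1 : ε ≤ 1 / 4 := by
    rw [hε]
    exact one_div_le_one_div_of_le (by norm_num) (by linarith)
  obtain ⟨S, hSf, hSp⟩ := hS n
  obtain ⟨y, hy, Z, -, hyZ, Γ, g1, g2, g3, g4⟩ := exists_legal (X := Y) (n := n) (S := S)
    (R := fun k T y => ∃ Z : ℕ+ →₀ ℝ, (∀ i ∈ Z.support, T < (i : ℕ)) ∧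
      ‖((∑ i, y i : Y) : XHalf) - toX Z‖ ≤ k * ε ∧ ∃ Γ, VFG W Γ ∧ Γ.length ≤ k ∧
      (∀ p ∈ Γ, T < p.2 ∧ ∀ i ∈ p.1.support, T < (i : ℕ)) ∧ k * (1 / (2 * C)) ≤ ev Z (tot Γ)) (by
      intro T y
      exact ⟨0, by simp, by simp, [], VFG.nil, by simp, by simp, by simp⟩) (by
      intro k T Z hZ
      -- Size `T + 1` is the least above `T`, which bounds all earlier sizes and supports.
      obtain ⟨y₀, h1, h2, u, h3, h4, a, h5, h6, h7⟩ := exists_large_index hY hC hS hZ T T.succ_pos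
        hε0 hε1
      obtain ⟨m, hm⟩ := exists_support_le u
      obtain ⟨m', hm'⟩ := exists_support_le a
      refine ⟨y₀, h1, h2, max (T + 1) (max m m'), ?_⟩
      rintro y ⟨Z', z1, z2, Γ, g1, g2, g3, g4⟩
      refine ⟨u + Z', fun i hi => ?_, ?_, [(a, T + 1)] ++ Γ, VFG.append (T := max (T + 1) (max m m'))
        ⟨by simpa using h5, by simp⟩ g1 ?_ g3, ?_, ?_, ?_⟩
      · rcases Finset.mem_union.mp (Finsupp.support_add hi) with h | h
        · exact h3 i h
        · have := z1 i h
          omega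
      · rw [Fin.sum_univ_succ]
        simp only [Fin.cons_zero, Fin.cons_succ]
        rw [map_add, Submodule.coe_add, add_sub_add_comm]
        refine (norm_add_le _ _).trans ?_
        push_cast at z2 ⊢
        linarith
      · intro q hq
        obtain rfl := List.mem_singleton.mp hq
        exact ⟨le_max_left _ _, fun i hi => by have := hm' i hi; omega⟩
      · simp only [List.length_append, List.length_singleton]
        omega
      · intro q hq
        rcases List.mem_append.mp hq with hq | hq
        · obtain rfl := List.mem_singleton.mp hq
          exact ⟨T.lt_succ_self, h6⟩
        · have := g3 q hq
          exact ⟨by omega, fun i hi => by have := this.2 i hi; omega⟩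
      · have e1 : ev u (tot Γ) = 0 := ev_tot_eq_zero fun q hq i hi => by
          by_contra hne
          have := hm i (by simpa using hne)
          have := (g3 q hq).2 i hi
          omega
        have e2 : ev Z' a = 0 := ev_eq_zero fun i hi => by
          by_contra hne
          have := z1 i (by simpa using hne)
          have := hm' i hi
          omega
        rw [tot_append, map_add, ev_add, ev_add]
        simp only [tot_cons, tot_nil, add_zero]
        rw [e1, e2]
        push_cast
        linarith) hSf n
  have h1 := ((hSp y hy).norm_sum_top hn0).2
  -- The play started with threshold `n`, so all supports lie beyond `n` and the list of at most `n`
  -- averages is admissible.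
  have h2 := (le_abs_self _).trans (abs_ev_tot_le g1 (fun q hq i hi => by
    have := (g3 q hq).2 i hi
    omega) Z)
  have h3 := norm_sub_le ((∑ i, y i : Y) : XHalf) (((∑ i, y i : Y) : XHalf) - toX Z)
  rw [sub_sub_cancel, norm_toX] at h3
  have h4 : ‖((∑ i, y i : Y) : XHalf)‖ = ‖∑ i, y i‖ := rfl
  have h5 : n * (1 / (2 * C)) ≤ 2 * (C + n * (1 / (8 * C))) := by linarith
  have h6 : n * (1 / (2 * C)) - 2 * (n * (1 / (8 * C))) = n / (4 * C) := by field_simp; norm_num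
  have h7 : n / (4 * C) ≤ 2 * C := by linarith
  rw [div_le_iff₀ (by positivity)] at h7
  nlinarith

end AsympSym

theorem mainTheorem1 :
    -- the space is asymptotically symmetric with constant 4
    AsympSym.IsAsymptoticallySymmetricWith 4 AsympSym.XHalf ∧
    -- and it answers the problem in the negative: it is infinite dimensional and has no
    -- infinite dimensional asymptotic-`ℓ_p` or asymptotic-`c₀` (`p = ∞`) closed subspace
    ¬ FiniteDimensional ℝ AsympSym.XHalf ∧
    ∀ (p : ENNReal), 1 ≤ p → ∀ Y : Submodule ℝ AsympSym.XHalf,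
      IsClosed (Y : Set AsympSym.XHalf) → ¬ FiniteDimensional ℝ Y →
        ¬ AsympSym.IsAsymptoticLp p Y := by
  refine ⟨AsympSym.isAsymptoticallySymmetricWith_XHalf, AsympSym.not_finiteDimensional_XHalf,
    fun p hp Y _ hY => ?_⟩
  rcases eq_or_ne p ⊤ with rfl | hp'
  · exact AsympSym.not_isAsymptoticLp_top hY
  · exact AsympSym.not_isAsymptoticLp_of_ne_top hY hp hp'
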